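/- **Setting.** Let $d\ge 2$, $\mathbb N=\{1,2,\dots\}$, and let $\{\xi_m,\ m\in\mathbb N^d\}$ be independent copies of an integrable random variable $\xi$ with mean $\mu=\mathbf E\xi>0$. For $x\in\mathbb R_+^d=[0,\infty)^d$ write $|x|=x^1\cdots x^d$. Put $S_n=\sum_{m\le n}\xi_m$ for $n\in\mathbb N^d$ (componentwise order) and $S_n=0$ if $n\in\{0,1,2,\dots\}^d$ has a vanishing component. Extend $S$ to $\mathbb R_+^d$ by piecewise multilinear interpolation: $S_x=\sum_k v_k(x)S_{k^*}$, where $k$ runs over the vertices of the unit lattice cube containing $x$, $v_k(x)$ is the volume of the box with faces parallel to the coordinate planes and opposite vertices $k$ and $x$, and $k^*$ is the vertex of the cube opposite to $k$. For $t>0$ and $c\in\mathbb R$ let $$M_t=\{x\in\mathbb R_+^d: S_x\ge t\},\qquad H(c)=\{x\in\mathbb R_+^d: |x|\ge\mu^{-1}+c\},\qquad H=H(0).$$ Let $\rho$ be the Euclidean distance, with $\rho(x,Y)=\inf_{y\in Y}\rho(x,y)$, let $\rho_H(X,Y)=\max\{\sup_{x\in X}\rho(x,Y),\ \sup_{y\in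 Y}\rho(y,X)\}\in[0,\infty]$ be the Hausdorff distance (with $\inf\emptyset=\infty$, $\sup\emptyset=0$), and let $\rho_\triangle^K(X,Y)=\lambda_d(K\cap(X\triangle Y))$, with $\lambda_d$ the Lebesgue measure. Also write $\rho_H^K(X,Y)=\max\{\sup_{x\in X\cap K}\rho(x,Y),\ \sup_{y\in Y\cap K}\rho(y,X)\}$. In the moment condition, $\log c$ is understood to be $1$ for $0\le c<e$. **Theorem (SLLN for renewal sets, metric version).** Let $\beta\in[1,2)$. 1. If $\mathbf E\big(|\xi|^\beta\log^{d-1}|\xi|\big)<\infty$, then $$\rho_H(t^{-1/d}M_t,H)=o(t^{-1+1/\beta})\quad\text{a.s. as }t\to\infty,$$ and, for every compact set $K\subset\mathbb R^d$, $$\rho_\triangle^K(t^{-1/d}M_t,H)=o(t^{-1+1/\beta})\quad\text{a.s. as }t\to\infty.$$ 2. If only $\mathbf E|\xi|^\beta<\infty$, then for every compact set $K\subset(0,\infty)^d$, almost surely as $t\to\infty$, $$\rho_\triangle^K(t^{-1/d}M_t,H)=o(t^{-1+1/\beta})\qquad\text{and}\qquad \rho_H^K(t^{-1/d}M_t,H)=o(t^{-1+1/\beta}).$$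 If, moreover, $K$ cuts the boundary of $H$ regularly, in the sense that $\rho_H(H(c)\cap K,\,H\cap K)=O(|c|)$ as $c\to0$, then also $$\rho_H\big((t^{-1/d}M_t)\cap K,\ H\cap K\big)=o(t^{-1+1/\beta})\quad\text{a.s. as }t\to\infty.$$ -/

import Mathlib

open Set Filter Topology MeasureTheory ProbabilityTheory
open scoped ENNReal Pointwise symmDiff

noncomputable section

namespace RenewalSets

/-- The logarithm with the convention `log c = 1` on `[0, e)`. -/
def extLog (c : ℝ) : ℝ := if c < Real.exp 1 then 1 else Real.log c

/-- `|x| = x¹ ⋯ xᵈ`. -/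
def coordProd {d : ℕ} (x : EuclideanSpace ℝ (Fin d)) : ℝ := ∏ i, x i

/-- The closed orthant `[0, ∞)ᵈ`. -/
def closedOrthant (d : ℕ) : Set (EuclideanSpace ℝ (Fin d)) := {x | ∀ i, 0 ≤ x i}

/-- The open orthant `(0, ∞)ᵈ`. -/
def openOrthant (d : ℕ) : Set (EuclideanSpace ℝ (Fin d)) := {x | ∀ i, 0 < x i}

/-- The multiple sum `S_n = ∑_{m ≤ n} a_m`, where `m` runs over vectors with positive integer
components. The shifted index `k`, `0 ≤ kⁱ < nⁱ`, stands for `m = k + (1, …, 1)`. If some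
component of `n` vanishes, the sum is empty and `S_n = 0`. -/
def multiSum {d : ℕ} (a : (Fin d → ℕ+) → ℝ) (n : Fin d → ℕ) : ℝ :=
  ∑ k ∈ Fintype.piFinset (fun i => Finset.range (n i)), a (fun i => (k i).succPNat)

/-- The vertices of the unit cube `∏ [⌊xⁱ⌋, ⌊xⁱ⌋ + 1]` containing `x`, indexed by the set `A` of
coordinates in which the upper end point is taken. The vertex opposite to `A` is that of `Aᶜ`. -/
def cubeVertex {d : ℕ} (x : EuclideanSpace ℝ (Fin d)) (A : Finset (Fin d)) : Fin d → ℕ :=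
  fun i => if i ∈ A then ⌊x i⌋₊ + 1 else ⌊x i⌋₊

/-- The piecewise multilinear interpolation `S_x = ∑_k v_k(x) S_{k*}`: the sum is over the
vertices `k` of the unit cube containing `x`, `v_k(x)` is the volume of the box with opposite
vertices `k` and `x`, and `k*` is the vertex opposite to `k`. -/
def interpSum {d : ℕ} (a : (Fin d → ℕ+) → ℝ) (x : EuclideanSpace ℝ (Fin d)) : ℝ :=
  ∑ A : Finset (Fin d), (∏ i, |x i - (cubeVertex x A i : ℝ)|) * multiSum a (cubeVertex x Aᶜ)

/-- The renewal set `M_t = {x ∈ [0, ∞)ᵈ : S_x ≥ t}`. -/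
def renewalSet {d : ℕ} (a : (Fin d → ℕ+) → ℝ) (t : ℝ) : Set (EuclideanSpace ℝ (Fin d)) :=
  {x | x ∈ closedOrthant d ∧ t ≤ interpSum a x}

/-- The rescaled renewal set `t^{-1/d} M_t`. -/
def scaledRenewalSet {d : ℕ} (a : (Fin d → ℕ+) → ℝ) (t : ℝ) :
    Set (EuclideanSpace ℝ (Fin d)) :=
  (t ^ (-(1 / (d : ℝ)))) • renewalSet a t

/-- `H(c) = {x ∈ [0, ∞)ᵈ : |x| ≥ μ⁻¹ + c}`. -/
def levelSet (d : ℕ) (μ c : ℝ) : Set (EuclideanSpace ℝ (Fin d)) :=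
  {x | x ∈ closedOrthant d ∧ μ⁻¹ + c ≤ coordProd x}

/-- The limit set `H = {x ∈ [0, ∞)ᵈ : |x| ≥ μ⁻¹}`. -/
def limitSet (d : ℕ) (μ : ℝ) : Set (EuclideanSpace ℝ (Fin d)) :=
  {x | x ∈ closedOrthant d ∧ μ⁻¹ ≤ coordProd x}

/-- The localised symmetric difference distance: the Lebesgue measure of `K ∩ (X ∆ Y)`. -/
def symmDiffDist {d : ℕ} (K X Y : Set (EuclideanSpace ℝ (Fin d))) : ℝ≥0∞ :=
  volume (K ∩ (X ∆ Y))

/-- The Hausdorff distance localised to `K`: the larger of the suprema of the distances from the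
points of `X ∩ K` to `Y` and from the points of `Y ∩ K` to `X`. -/
def localHausdorffEDist {d : ℕ} (K X Y : Set (EuclideanSpace ℝ (Fin d))) : ℝ≥0∞ :=
  max (⨆ x ∈ X ∩ K, Metric.infEDist x Y) (⨆ y ∈ Y ∩ K, Metric.infEDist y X)

/-- `K` cuts the boundary of `H` regularly: the Hausdorff distance between `H(c) ∩ K` and
`H ∩ K` is `O(|c|)` as `c → 0`. -/
def CutsRegularly {d : ℕ} (μ : ℝ) (K : Set (EuclideanSpace ℝ (Fin d))) : Prop :=
  ∃ C : ℝ, ∀ᶠ c in 𝓝 (0 : ℝ),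
    Metric.hausdorffEDist (levelSet d μ c ∩ K) (limitSet d μ ∩ K) ≤ ENNReal.ofReal (C * |c|)

/-- `f(t) = o(g(t))` as `t → ∞` for a function `f` with values in `[0, ∞]`; in particular, `f` is
eventually finite. -/
def IsLittleOAtTop (f : ℝ → ℝ≥0∞) (g : ℝ → ℝ) : Prop :=
  (∀ᶠ t in atTop, f t ≠ ⊤) ∧ Asymptotics.IsLittleO atTop (fun t => (f t).toReal) g

end RenewalSets

end

/-! ### Multilinear interpolation -/

namespace RenewalSets

/-! Put `g t = t ^ (-1 + 1 / β)`. Everything follows from one almost sure estimate (`UniformRate`):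
the interpolated sum at `t ^ (1 / d) • u` differs from `μ t |u|` by at most `ε g(t) t (1 + |u|)`,
uniformly in `u`. Dividing by `t` squeezes the rescaled renewal set between `H(δ g)` and `H(-δ g)`
(`Squeezed`), and the rest is deterministic geometry. Level sets whose levels differ by `η` are
`O(η)` apart in Hausdorff distance, because stretching the smallest coordinate, which is bounded
near the level set, raises the product cheaply. By Fubini the region between them has volume `O(η)`
inside a bounded box.

The estimate is a Marcinkiewicz–Zygmund law. In a box of volume `2 ^ m` the variables are truncated
at `2 ^ (m / β)`. Chebyshev's inequality and Ottaviani's inequality, iterated over the coordinates,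
bound the largest deviation over all sub-boxes with the same lower corner. The moment condition
makes these probabilities summable, and Borel–Cantelli leaves finitely many bad boxes, absorbed into
a constant.

The two moment conditions come from two families of boxes. On the whole orthant all dyadic boxes are
needed; at most `(m + 1) ^ (d - 1)` of them have volume `2 ^ m`, hence the factor `log ^ (d - 1)`.
On a bounded region dyadic cubes suffice, at most one for each volume, and no logarithm appears. -/

theorem sum_prod_abs_sub_cubeVertex_mul {d : ℕ} {x : EuclideanSpace ℝ (Fin d)}
    (hx : x ∈ closedOrthant d) (f : Fin d → ℕ → ℝ) :
    ∑ A : Finset (Fin d), (∏ i, |x i - (cubeVertex x A i : ℝ)|) * ∏ i, f i (cubeVertex x Aᶜ i) =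
      ∏ i, ((⌊x i⌋₊ + 1 - x i) * f i ⌊x i⌋₊ + (x i - ⌊x i⌋₊) * f i (⌊x i⌋₊ + 1)) := by
  -- Expanding the product gives one term for each `A`. For `i ∈ A` the weight is the distance to
  -- the upper end point, while the opposite vertex `Aᶜ` takes the lower one.
  rw [Finset.prod_add, Finset.powerset_univ]
  refine Finset.sum_congr rfl fun A _ => ?_
  rw [← Finset.prod_mul_distrib, ← Finset.prod_mul_prod_compl A, Finset.compl_eq_univ_sdiff]
  congr 1
  · refine Finset.prod_congr rfl fun i hi => ?_
    simp only [cubeVertex, hi, if_true, Finset.mem_sdiff, not_true, and_false, if_false]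
    rw [abs_sub_comm, Nat.cast_add, Nat.cast_one, abs_of_nonneg]
    linarith [Nat.lt_floor_add_one (x i)]
  · refine Finset.prod_congr rfl fun i hi => ?_
    have hi' : i ∉ A := (Finset.mem_sdiff.1 hi).2
    simp only [cubeVertex, hi', if_false, hi, if_true]
    rw [abs_of_nonneg]
    linarith [Nat.floor_le (hx i)]

theorem sum_prod_abs_sub_cubeVertex {d : ℕ} {x : EuclideanSpace ℝ (Fin d)}
    (hx : x ∈ closedOrthant d) :
    ∑ A : Finset (Fin d), ∏ i, |x i - (cubeVertex x A i : ℝ)| = 1 := by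
  have := sum_prod_abs_sub_cubeVertex_mul hx fun _ _ => 1
  simpa using this

theorem sum_prod_abs_sub_cubeVertex_mul_prod {d : ℕ} {x : EuclideanSpace ℝ (Fin d)}
    (hx : x ∈ closedOrthant d) :
    ∑ A : Finset (Fin d), (∏ i, |x i - (cubeVertex x A i : ℝ)|) *
      ∏ i, (cubeVertex x Aᶜ i : ℝ) = coordProd x := by
  rw [sum_prod_abs_sub_cubeVertex_mul hx fun _ k => (k : ℝ), coordProd]
  refine Finset.prod_congr rfl fun i _ => ?_
  push_cast
  ring

/-- A bound for the deviation of `S_n` from `μ |n|` which is affine in `|n|` carries over to the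
multilinear interpolation. -/
theorem abs_interpSum_sub_le {d : ℕ} (a : (Fin d → ℕ+) → ℝ) (μ p q : ℝ)
    {x : EuclideanSpace ℝ (Fin d)} (hx : x ∈ closedOrthant d)
    (h : ∀ A, |multiSum a (cubeVertex x A) - μ * ∏ i, (cubeVertex x A i : ℝ)| ≤
      p + q * ∏ i, (cubeVertex x A i : ℝ)) :
    |interpSum a x - μ * coordProd x| ≤ p + q * coordProd x := by
  have h1 := sum_prod_abs_sub_cubeVertex hx
  have h2 := sum_prod_abs_sub_cubeVertex_mul_prod hx
  calc |interpSum a x - μ * coordProd x|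
      = |∑ A : Finset (Fin d), (∏ i, |x i - (cubeVertex x A i : ℝ)|) *
          (multiSum a (cubeVertex x Aᶜ) - μ * ∏ i, (cubeVertex x Aᶜ i : ℝ))| := by
        rw [← h2, interpSum, Finset.mul_sum, ← Finset.sum_sub_distrib]
        congr 1
        exact Finset.sum_congr rfl fun A _ => by ring
    _ ≤ ∑ A : Finset (Fin d), (∏ i, |x i - (cubeVertex x A i : ℝ)|) *
          (p + q * ∏ i, (cubeVertex x Aᶜ i : ℝ)) := by
        refine (Finset.abs_sum_le_sum_abs _ _).trans (Finset.sum_le_sum fun A _ => ?_)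
        have h0 : 0 ≤ ∏ i, |x i - (cubeVertex x A i : ℝ)| :=
          Finset.prod_nonneg fun _ _ => abs_nonneg _
        rw [abs_mul, abs_of_nonneg h0]
        exact mul_le_mul_of_nonneg_left (h _) h0
    _ = p * 1 + q * coordProd x := by
        rw [← h1, ← h2, Finset.mul_sum, Finset.mul_sum, ← Finset.sum_add_distrib]
        exact Finset.sum_congr rfl fun A _ => by ring
    _ = p + q * coordProd x := by ring

theorem coordProd_nonneg {d : ℕ} {x : EuclideanSpace ℝ (Fin d)} (hx : x ∈ closedOrthant d) :
    0 ≤ coordProd x := Finset.prod_nonneg fun i _ => hx i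

theorem coordProd_smul {d : ℕ} (c : ℝ) (x : EuclideanSpace ℝ (Fin d)) :
    coordProd (c • x) = c ^ d * coordProd x := by
  simp [coordProd, Finset.prod_mul_distrib]

theorem rpow_one_div_pow {d : ℕ} (hd : d ≠ 0) {t : ℝ} (ht : 0 ≤ t) :
    (t ^ (1 / (d : ℝ))) ^ d = t := by
  rw [one_div, Real.rpow_inv_natCast_pow ht hd]

theorem mem_scaledRenewalSet {d : ℕ} (a : (Fin d → ℕ+) → ℝ) {t : ℝ} (ht : 0 < t)
    {u : EuclideanSpace ℝ (Fin d)} :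
    u ∈ scaledRenewalSet a t ↔
      u ∈ closedOrthant d ∧ t ≤ interpSum a ((t ^ (1 / (d : ℝ))) • u) := by
  have hp : 0 < t ^ (1 / (d : ℝ)) := Real.rpow_pos_of_pos ht _
  rw [scaledRenewalSet, Real.rpow_neg ht.le, Set.mem_smul_set_iff_inv_smul_mem₀ (by positivity),
    inv_inv]
  simp only [renewalSet, closedOrthant, Set.mem_ofPred_eq, PiLp.smul_apply, smul_eq_mul]
  simp only [mul_nonneg_iff_of_pos_left hp]

/-! ### Squeezing between level sets and Hausdorff distance -/

/-- Stretching the smallest coordinate. -/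
theorem exists_le_coordProd_dist_le {d : ℕ} (hd : d ≠ 0) {x : EuclideanSpace ℝ (Fin d)}
    (hx : x ∈ closedOrthant d) {a b : ℝ} (ha : 0 < a) (hab : a ≤ b) (hax : a ≤ coordProd x) :
    ∃ y ∈ closedOrthant d, b ≤ coordProd y ∧ dist x y ≤ (1 + b) * (b / a - 1) := by
  have hba : 1 ≤ b / a := (one_le_div ha).2 hab
  by_cases hbx : b ≤ coordProd x
  · refine ⟨x, hx, hbx, ?_⟩
    rw [dist_self]
    exact mul_nonneg (by linarith) (by linarith)
  push Not at hbx
  have : Nonempty (Fin d) := ⟨⟨0, Nat.pos_of_ne_zero hd⟩⟩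
  obtain ⟨i₀, hi₀⟩ := Finite.exists_min fun i => x i
  -- Otherwise every coordinate exceeds `1 + b`, and the product is at least `(1 + b) ^ d ≥ 1 + b >
  -- b`.
  have hle : x i₀ ≤ 1 + b := by
    by_contra hcon
    push Not at hcon
    have h1 : (1 + b) ^ d ≤ coordProd x := by
      have := Finset.prod_le_prod (s := (Finset.univ : Finset (Fin d)))
        (f := fun _ => 1 + b) (g := fun i => x i)
        (fun _ _ => by linarith) (fun i _ => hcon.le.trans (hi₀ i))
      simpa [coordProd] using this
    have h2 : 1 + b ≤ (1 + b) ^ d := le_self_pow₀ (by linarith) hd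
    linarith
  refine ⟨WithLp.toLp 2 (Function.update x i₀ (b / a * x i₀)), ?_, ?_, ?_⟩
  · intro i
    by_cases h : i = i₀
    · subst h; simpa using mul_nonneg (by linarith) (hx i)
    · simpa [Function.update_of_ne h] using hx i
  · have h1 : coordProd (WithLp.toLp 2 (Function.update x i₀ (b / a * x i₀)) :
        EuclideanSpace ℝ (Fin d)) = b / a * coordProd x := by
      simp only [coordProd]
      rw [← Finset.mul_prod_erase Finset.univ _ (Finset.mem_univ i₀),
        ← Finset.mul_prod_erase Finset.univ (fun i => x i) (Finset.mem_univ i₀), ← mul_assoc]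
      congr 1
      · simp
      · refine Finset.prod_congr rfl fun i hi => ?_
        simp [Function.update_of_ne (Finset.ne_of_mem_erase hi)]
    rw [h1]
    calc b = b / a * a := by field_simp
      _ ≤ _ := by gcongr
  · rw [EuclideanSpace.dist_eq]
    have h1 : ∑ i, dist (x i) ((WithLp.toLp 2 (Function.update x i₀ (b / a * x i₀)) :
        EuclideanSpace ℝ (Fin d)) i) ^ 2 = ((b / a - 1) * x i₀) ^ 2 := by
      rw [Finset.sum_eq_single i₀]
      · simp only [Function.update_self, Real.dist_eq, sq_abs]
        ring
      · intro i _ hi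
        simp [Function.update_of_ne hi]
      · simp
    rw [h1, Real.sqrt_sq (mul_nonneg (by linarith) (hx i₀)), mul_comm]
    exact mul_le_mul_of_nonneg_right hle (by linarith)

theorem isLittleOAtTop_of_forall_le {f : ℝ → ℝ≥0∞} {g : ℝ → ℝ}
    (h : ∀ δ > 0, ∀ᶠ t in atTop, f t ≤ ENNReal.ofReal (δ * g t)) : IsLittleOAtTop f g := by
  refine ⟨(h 1 one_pos).mono fun t ht => (ht.trans_lt ENNReal.ofReal_lt_top).ne, ?_⟩
  rw [Asymptotics.isLittleO_iff]
  intro c hc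
  filter_upwards [h c hc] with t ht
  rw [Real.norm_of_nonneg ENNReal.toReal_nonneg]
  by_cases hg : 0 ≤ g t
  · rw [Real.norm_of_nonneg hg]
    exact ENNReal.toReal_le_of_le_ofReal (by positivity) ht
  -- Where `g t < 0`, `ENNReal.ofReal` truncates the bound to `0`, so `f t = 0`.
  · rw [ENNReal.ofReal_of_nonpos (mul_nonpos_of_nonneg_of_nonpos hc.le (not_le.1 hg).le)] at ht
    simp only [nonpos_iff_eq_zero] at ht
    rw [ht]
    simp only [ENNReal.toReal_zero]
    positivity

/-- The rescaled interpolated sums approach `μ |u|` at the rate `o(g t)` on `U`. -/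
def UniformRate {d : ℕ} (a : (Fin d → ℕ+) → ℝ) (μ : ℝ) (g : ℝ → ℝ)
    (U : Set (EuclideanSpace ℝ (Fin d))) : Prop :=
  ∀ ε > 0, ∀ᶠ t in atTop, ∀ u ∈ U, u ∈ closedOrthant d →
    |interpSum a ((t ^ (1 / (d : ℝ))) • u) - μ * (t * coordProd u)| ≤
      ε * g t * t * (1 + coordProd u)

/-- The renewal set is eventually squeezed between level sets on `U`. -/
def Squeezed {d : ℕ} (a : (Fin d → ℕ+) → ℝ) (μ : ℝ) (g : ℝ → ℝ)
    (U : Set (EuclideanSpace ℝ (Fin d))) : Prop :=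
  ∀ δ > 0, ∀ᶠ t in atTop, ∀ u ∈ U,
    (u ∈ scaledRenewalSet a t → u ∈ levelSet d μ (-(δ * g t))) ∧
    (u ∈ levelSet d μ (δ * g t) → u ∈ scaledRenewalSet a t)

theorem UniformRate.squeezed {d : ℕ} {a : (Fin d → ℕ+) → ℝ} {μ : ℝ} (hμ : 0 < μ)
    {g : ℝ → ℝ} (hg0 : ∀ᶠ t in atTop, 0 ≤ g t) (hg1 : ∀ᶠ t in atTop, g t ≤ 1)
    {U : Set (EuclideanSpace ℝ (Fin d))} (h : UniformRate a μ g U) : Squeezed a μ g U := by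
  intro δ hδ
  have hμi : 0 < μ⁻¹ := inv_pos.2 hμ
  -- Chosen so that `ε (1 + |u|) ≤ δ μ` as long as `|u| ≤ μ⁻¹ + δ`; it also gives `ε ≤ μ`.
  set ε := δ * μ / (μ⁻¹ + δ + 1) with hε
  have hden : 0 < μ⁻¹ + δ + 1 := by positivity
  have hεpos : 0 < ε := by positivity
  have hεeq : ε * (μ⁻¹ + δ + 1) = δ * μ := by rw [hε]; field_simp
  have hεμ : ε ≤ μ := by
    rw [hε, div_le_iff₀ hden]
    nlinarith
  filter_upwards [h ε hεpos, hg0, hg1, eventually_gt_atTop 0] with t ht h0 h1 htpos u hu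
  have hεg : 0 ≤ ε * g t := by positivity
  have hεg1 : ε * g t ≤ ε := by nlinarith
  constructor
  · rw [mem_scaledRenewalSet a htpos]
    rintro ⟨huo, hS⟩
    refine ⟨huo, ?_⟩
    have hb := (abs_le.1 (ht u hu huo)).2
    by_cases hcase : μ⁻¹ ≤ coordProd u
    · have : 0 ≤ δ * g t := by positivity
      linarith
    push Not at hcase
    have h3 : t * (1 - ε * g t * (1 + coordProd u)) ≤ t * (μ * coordProd u) := by
      linarith
    have h4 := le_of_mul_le_mul_left h3 htpos
    have h5 : ε * g t * (1 + coordProd u) ≤ ε * g t * (μ⁻¹ + δ + 1) := by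
      apply mul_le_mul_of_nonneg_left _ hεg
      linarith
    have h6 : ε * g t * (μ⁻¹ + δ + 1) = δ * g t * μ := by
      calc _ = ε * (μ⁻¹ + δ + 1) * g t := by ring
        _ = _ := by rw [hεeq]; ring
    have h7 : μ * (μ⁻¹ + -(δ * g t)) ≤ μ * coordProd u := by
      rw [mul_add, mul_inv_cancel₀ hμ.ne']
      linarith
    exact le_of_mul_le_mul_left h7 hμ
  · rintro ⟨huo, hlev⟩
    rw [mem_scaledRenewalSet a htpos]
    refine ⟨huo, ?_⟩
    have hb := (abs_le.1 (ht u hu huo)).1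
    -- Here `|u|` is not bounded above, but the lower bound `|u| (μ - ε g) - ε g` is nondecreasing
    -- in `|u|`, so the smallest admissible value `μ⁻¹ + δ g` decides.
    have h3 : (μ⁻¹ + δ * g t) * (μ - ε * g t) ≤ coordProd u * (μ - ε * g t) :=
      mul_le_mul_of_nonneg_right hlev (by linarith)
    have h4 : 1 ≤ (μ⁻¹ + δ * g t) * (μ - ε * g t) - ε * g t := by
      have e1 : μ⁻¹ * μ = 1 := inv_mul_cancel₀ hμ.ne'
      have e2 : δ * g t * μ = ε * g t * (μ⁻¹ + δ + 1) := by
        calc _ = (δ * μ) * g t := by ring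
          _ = _ := by rw [← hεeq]; ring
      have e3 : δ * g t * (ε * g t) ≤ δ * (ε * g t) := by
        apply mul_le_mul_of_nonneg_right _ hεg
        nlinarith
      nlinarith
    have h5 : t * 1 ≤ t * (coordProd u * (μ - ε * g t) - ε * g t) :=
      mul_le_mul_of_nonneg_left (by linarith) htpos.le
    linarith

/-- The bound on `η₁` keeps the lower level above `μ⁻¹ / 2`, so the relative stretch is at most `2 μ
(η₁ + η₂)`; the bound on `η₂` keeps the stretched coordinate below `1 + 2 μ⁻¹`. -/
theorem exists_mem_levelSet_dist_le {d : ℕ} (hd : d ≠ 0) {μ η₁ η₂ : ℝ} (hμ : 0 < μ)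
    (h₁ : η₁ ≤ μ⁻¹ / 2) (h₂ : η₂ ≤ μ⁻¹) (h₁₂ : 0 ≤ η₁ + η₂) {x : EuclideanSpace ℝ (Fin d)}
    (hx : x ∈ levelSet d μ (-η₁)) :
    ∃ y ∈ levelSet d μ η₂, dist x y ≤ (1 + 2 * μ⁻¹) * (2 * μ) * (η₁ + η₂) := by
  have hμi : 0 < μ⁻¹ := inv_pos.2 hμ
  have ha : 0 < μ⁻¹ + -η₁ := by linarith
  obtain ⟨y, hy, hby, hdist⟩ := exists_le_coordProd_dist_le hd hx.1 ha
    (show μ⁻¹ + -η₁ ≤ μ⁻¹ + η₂ by linarith) hx.2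
  refine ⟨y, ⟨hy, hby⟩, hdist.trans ?_⟩
  have h3 : (μ⁻¹ + η₂) / (μ⁻¹ + -η₁) - 1 = (η₁ + η₂) / (μ⁻¹ + -η₁) := by
    rw [div_sub_one ha.ne']
    congr 1
    ring
  have h4 : (η₁ + η₂) / (μ⁻¹ + -η₁) ≤ 2 * μ * (η₁ + η₂) := by
    rw [div_le_iff₀ ha]
    have : 1 ≤ 2 * μ * (μ⁻¹ + -η₁) := by
      have e1 : μ * μ⁻¹ = 1 := mul_inv_cancel₀ hμ.ne'
      nlinarith
    nlinarith
  rw [h3, mul_assoc]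
  apply mul_le_mul _ h4 (by positivity) (by positivity)
  linarith

theorem limitSet_eq_levelSet {d : ℕ} (μ : ℝ) : limitSet d μ = levelSet d μ 0 := by
  simp [limitSet, levelSet]

/-- Points of `X` in the region `U` and points of the limit set are close to the other set. -/
theorem Squeezed.localHausdorff {d : ℕ} (hd : d ≠ 0) {a : (Fin d → ℕ+) → ℝ} {μ : ℝ} (hμ : 0 < μ)
    {g : ℝ → ℝ} (hg0 : ∀ᶠ t in atTop, 0 ≤ g t) (hg1 : ∀ᶠ t in atTop, g t ≤ 1)
    {U K : Set (EuclideanSpace ℝ (Fin d))} (hKU : ∀ x ∈ K, ∀ y, dist x y ≤ 1 → y ∈ U)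
    (h : Squeezed a μ g U) :
    ∀ δ > 0, ∀ᶠ t in atTop,
      (∀ x ∈ scaledRenewalSet a t ∩ K, Metric.infEDist x (limitSet d μ) ≤
        ENNReal.ofReal (δ * g t)) ∧
      (∀ y ∈ limitSet d μ ∩ K, Metric.infEDist y (scaledRenewalSet a t) ≤
        ENNReal.ofReal (δ * g t)) := by
  intro δ hδ
  have hμi : 0 < μ⁻¹ := inv_pos.2 hμ
  set C := (1 + 2 * μ⁻¹) * (2 * μ) with hC
  have hCpos : 0 < C := by positivity
  -- The three terms give the final bound, the smallness of the level shift, and a displacement of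
  -- at most `1`, so that the moved point stays in `U`, where the squeezing holds.
  set δ' := min (min (δ / C) (μ⁻¹ / 2)) (1 / C) with hδ'
  have hδ'pos : 0 < δ' := by positivity
  have hδ1 : C * δ' ≤ δ := by
    have : δ' ≤ δ / C := (min_le_left _ _).trans (min_le_left _ _)
    rw [le_div_iff₀ hCpos] at this; linarith
  have hδ2 : δ' ≤ μ⁻¹ / 2 := (min_le_left _ _).trans (min_le_right _ _)
  have hδ3 : C * δ' ≤ 1 := by
    have : δ' ≤ 1 / C := min_le_right _ _
    rw [le_div_iff₀ hCpos] at this; linarith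
  filter_upwards [h δ' hδ'pos, hg0, hg1] with t ht h0 h1
  have hdg0 : 0 ≤ δ' * g t := by positivity
  have hdg : δ' * g t ≤ δ' := by nlinarith
  have hCg : C * (δ' * g t) ≤ δ * g t := by
    rw [← mul_assoc]; exact mul_le_mul_of_nonneg_right hδ1 h0
  constructor
  · rintro x ⟨hx, hxK⟩
    obtain ⟨y, hy, hxy⟩ := exists_mem_levelSet_dist_le hd hμ (η₁ := δ' * g t) (η₂ := 0) (by linarith)
      hμi.le (by linarith) ((ht x (hKU x hxK x (by simp))).1 hx)
    rw [← limitSet_eq_levelSet] at hy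
    refine (Metric.infEDist_le_edist_of_mem hy).trans ?_
    rw [edist_dist]
    exact ENNReal.ofReal_le_ofReal (hxy.trans (by rw [add_zero]; exact hCg))
  · rintro y ⟨hy, hyK⟩
    rw [limitSet_eq_levelSet, ← neg_zero] at hy
    obtain ⟨x, hx, hxy⟩ := exists_mem_levelSet_dist_le hd hμ (η₁ := 0) (η₂ := δ' * g t) (by linarith)
      (by linarith) (by linarith) hy
    rw [zero_add] at hxy
    have hxU : x ∈ U := hKU y hyK x (hxy.trans (by nlinarith))
    refine (Metric.infEDist_le_edist_of_mem ((ht x hxU).2 hx)).trans ?_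
    rw [edist_dist]
    exact ENNReal.ofReal_le_ofReal (hxy.trans hCg)

/-- Intersecting the squeeze with `K` places the renewal set between `H(± δ' g) ∩ K`, and regularity
controls both of these sets directly. -/
theorem Squeezed.cutsRegularly {d : ℕ} {a : (Fin d → ℕ+) → ℝ} {μ : ℝ}
    {g : ℝ → ℝ} (hg0 : ∀ᶠ t in atTop, 0 ≤ g t) (hg1 : ∀ᶠ t in atTop, g t ≤ 1)
    {K : Set (EuclideanSpace ℝ (Fin d))} (h : Squeezed a μ g K) (hK : CutsRegularly μ K) :
    ∀ δ > 0, ∀ᶠ t in atTop,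
      Metric.hausdorffEDist (scaledRenewalSet a t ∩ K) (limitSet d μ ∩ K) ≤
        ENNReal.ofReal (δ * g t) := by
  intro δ hδ
  obtain ⟨C, hC⟩ := hK
  obtain ⟨r, hr, hball⟩ := Metric.eventually_nhds_iff.1 hC
  -- `r / 2` keeps `± δ' g` in the range where regularity applies; `|C| + 1` is positive whatever
  -- the sign of `C`.
  set δ' := min (r / 2) (δ / (|C| + 1)) with hδ'
  have hC1 : 0 < |C| + 1 := by positivity
  have hδ'pos : 0 < δ' := by positivity
  have hδ'r : δ' < r := (min_le_left _ _).trans_lt (by linarith)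
  have hδ'C : C * δ' ≤ δ := by
    have h1 : δ' ≤ δ / (|C| + 1) := min_le_right _ _
    rw [le_div_iff₀ hC1] at h1
    nlinarith [le_abs_self C]
  filter_upwards [h δ' hδ'pos, hg0, hg1] with t ht h0 h1
  have hdg0 : 0 ≤ δ' * g t := by positivity
  have hdg : δ' * g t < r := lt_of_le_of_lt (by nlinarith) hδ'r
  have hb : C * (δ' * g t) ≤ δ * g t := by
    rw [← mul_assoc]; exact mul_le_mul_of_nonneg_right hδ'C h0
  have hp := hball (y := δ' * g t) (by rwa [Real.dist_eq, sub_zero, abs_of_nonneg hdg0])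
  have hn := hball (y := -(δ' * g t)) (by rwa [Real.dist_eq, sub_zero, abs_neg, abs_of_nonneg hdg0])
  rw [abs_of_nonneg hdg0] at hp
  rw [abs_neg, abs_of_nonneg hdg0] at hn
  refine Metric.hausdorffEDist_le_of_infEDist ?_ ?_
  · rintro x ⟨hx, hxK⟩
    have hx' : x ∈ levelSet d μ (-(δ' * g t)) ∩ K := ⟨(ht x hxK).1 hx, hxK⟩
    exact ((Metric.infEDist_le_hausdorffEDist_of_mem hx').trans hn).trans
      (ENNReal.ofReal_le_ofReal hb)
  · rintro y hy
    rw [Metric.hausdorffEDist_comm] at hp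
    refine le_trans (Metric.infEDist_anti ?_)
      (((Metric.infEDist_le_hausdorffEDist_of_mem hy).trans hp).trans
        (ENNReal.ofReal_le_ofReal hb))
    exact fun x hx => ⟨(ht x hx.2).2 hx.1, hx.2⟩

/-! ### Volume between level sets -/

/-- The part of `[0, R]ᵈ` between two level sets has volume of the order of the difference of
the levels. -/
theorem volume_setOf_abs_prod_sub_le {n : ℕ} {a R η : ℝ} (ha : 0 < a)
    (hη : 0 ≤ η) (hηa : η ≤ a / 2) :
    volume {x : Fin (n + 1) → ℝ | (∀ i, x i ∈ Icc 0 R) ∧ |∏ i, x i - a| ≤ η} ≤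
      ENNReal.ofReal (4 * R / a * η) * ENNReal.ofReal R ^ n := by
  set B : Set (ℝ × (Fin n → ℝ)) :=
    {z | (z.1 ∈ Icc 0 R ∧ ∀ i, z.2 i ∈ Icc 0 R) ∧ |z.1 * ∏ i, z.2 i - a| ≤ η} with hB
  have hBm : MeasurableSet B := by
    refine MeasurableSet.inter (MeasurableSet.inter ?_ ?_) ?_
    · exact measurable_fst measurableSet_Icc
    · have : {z : ℝ × (Fin n → ℝ) | ∀ i, z.2 i ∈ Icc 0 R} = ⋂ i, {z | z.2 i ∈ Icc 0 R} := by
        ext; simp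
      change MeasurableSet {z : ℝ × (Fin n → ℝ) | ∀ i, z.2 i ∈ Icc 0 R}
      rw [this]
      exact MeasurableSet.iInter fun i =>
        ((measurable_pi_apply i).comp measurable_snd) measurableSet_Icc
    · change MeasurableSet {z : ℝ × (Fin n → ℝ) | |z.1 * ∏ i, z.2 i - a| ≤ η}
      exact measurableSet_le (by fun_prop) measurable_const
  have hpre : {x : Fin (n + 1) → ℝ | (∀ i, x i ∈ Icc 0 R) ∧ |∏ i, x i - a| ≤ η} =
      (MeasurableEquiv.piFinSuccAbove (fun _ : Fin (n + 1) => ℝ) 0) ⁻¹' B := by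
    ext x
    simp [hB, Fin.forall_fin_succ, Fin.prod_univ_succ, MeasurableEquiv.piFinSuccAbove,
      Fin.insertNthEquiv, Fin.tail]
  rw [hpre, (volume_preserving_piFinSuccAbove (fun _ : Fin (n + 1) => ℝ) 0).measure_preimage
    hBm.nullMeasurableSet, Measure.volume_eq_prod, Measure.prod_apply_symm hBm]
  -- With the other coordinates fixed and `p` their product, the slice lies in an interval of length
  -- `2 η / p`. A nonempty slice forces `R p ≥ a - η ≥ a / 2`, so this length is at most `4 R η /
  -- a`.
  have hslice : ∀ y : Fin n → ℝ, volume ((fun s : ℝ => (s, y)) ⁻¹' B) ≤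
      (Set.univ.pi fun _ : Fin n => Icc 0 R).indicator
        (fun _ => ENNReal.ofReal (4 * R / a * η)) y := by
    intro y
    by_cases hne : ((fun s : ℝ => (s, y)) ⁻¹' B).Nonempty
    · obtain ⟨s₀, ⟨hs₀, hy⟩, hs₀'⟩ := hne
      simp only at hs₀ hy hs₀'
      rw [Set.indicator_of_mem (Set.mem_univ_pi.2 hy)]
      set p := ∏ i, y i with hp
      have hp0 : 0 ≤ p := Finset.prod_nonneg fun i _ => (hy i).1
      have h1 : a / 2 ≤ R * p := by
        have := (abs_le.1 hs₀').1
        have := mul_le_mul_of_nonneg_right hs₀.2 hp0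
        linarith
      have hppos : 0 < p := by
        by_contra hcon
        have : p = 0 := le_antisymm (not_lt.1 hcon) hp0
        rw [this] at h1
        linarith
      have hsub : (fun s : ℝ => (s, y)) ⁻¹' B ⊆ Icc ((a - η) / p) ((a + η) / p) := by
        rintro s ⟨-, hs⟩
        have hs' := abs_le.1 hs
        simp only [← hp] at hs'
        constructor
        · rw [div_le_iff₀ hppos]; linarith
        · rw [le_div_iff₀ hppos]; linarith
      refine (measure_mono hsub).trans ?_
      rw [Real.volume_Icc]
      refine ENNReal.ofReal_le_ofReal ?_
      rw [div_sub_div_same, div_le_iff₀ hppos]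
      have h2 : 4 * R / a * η * p = 4 * (R * p) * η / a := by ring
      rw [h2, le_div_iff₀ ha]
      nlinarith
    · rw [Set.not_nonempty_iff_eq_empty.1 hne, measure_empty]
      exact zero_le
  refine (lintegral_mono hslice).trans ?_
  rw [lintegral_indicator_const (MeasurableSet.univ_pi fun _ => measurableSet_Icc), volume_pi_pi]
  simp

theorem Squeezed.symmDiffDist {d : ℕ} (hd : d ≠ 0) {a : (Fin d → ℕ+) → ℝ} {μ : ℝ} (hμ : 0 < μ)
    {g : ℝ → ℝ} (hg0 : ∀ᶠ t in atTop, 0 ≤ g t) (hg1 : ∀ᶠ t in atTop, g t ≤ 1)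
    {K : Set (EuclideanSpace ℝ (Fin d))} (hK : IsCompact K) (h : Squeezed a μ g K) :
    ∀ δ > 0, ∀ᶠ t in atTop,
      symmDiffDist K (scaledRenewalSet a t) (limitSet d μ) ≤ ENNReal.ofReal (δ * g t) := by
  intro δ hδ
  obtain ⟨n, rfl⟩ := Nat.exists_eq_succ_of_ne_zero hd
  have hμi : 0 < μ⁻¹ := inv_pos.2 hμ
  obtain ⟨R, hR, hKR⟩ := hK.isBounded.exists_pos_norm_le
  set C := 4 * R / μ⁻¹ * R ^ n with hC
  have hCpos : 0 < C := by positivity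
  set δ' := min (δ / C) (μ⁻¹ / 2) with hδ'
  have hδ'pos : 0 < δ' := by positivity
  have hδ1 : C * δ' ≤ δ := by
    have : δ' ≤ δ / C := min_le_left _ _
    rw [le_div_iff₀ hCpos] at this; linarith
  have hδ2 : δ' ≤ μ⁻¹ / 2 := min_le_right _ _
  filter_upwards [h δ' hδ'pos, hg0, hg1] with t ht h0 h1
  have hdg0 : 0 ≤ δ' * g t := by positivity
  have hdg : δ' * g t ≤ δ' := by nlinarith
  have hsub : K ∩ (scaledRenewalSet a t ∆ limitSet (n + 1) μ) ⊆
      WithLp.ofLp ⁻¹' {x : Fin (n + 1) → ℝ | (∀ i, x i ∈ Icc 0 R) ∧ |∏ i, x i - μ⁻¹| ≤ δ' * g t} := by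
    rintro x ⟨hxK, hx⟩
    have hbound : ∀ i, x i ≤ R := fun i =>
      (le_abs_self _).trans ((PiLp.norm_apply_le x i).trans (hKR x hxK))
    rcases hx with ⟨hxM, hxH⟩ | ⟨hxH, hxM⟩
    · have hl := (ht x hxK).1 hxM
      refine ⟨fun i => ⟨hl.1 i, hbound i⟩, ?_⟩
      have h2 : coordProd x < μ⁻¹ := by
        by_contra hcon
        exact hxH ⟨hl.1, not_lt.1 hcon⟩
      have h3 := hl.2
      unfold coordProd at h2 h3
      rw [abs_le]
      constructor <;> linarith
    · refine ⟨fun i => ⟨hxH.1 i, hbound i⟩, ?_⟩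
      have h2 : coordProd x < μ⁻¹ + δ' * g t := by
        by_contra hcon
        exact hxM ((ht x hxK).2 ⟨hxH.1, not_lt.1 hcon⟩)
      have h3 := hxH.2
      unfold coordProd at h2 h3
      rw [abs_le]
      constructor <;> linarith
  refine (measure_mono hsub).trans ?_
  have hclosed : MeasurableSet
      {x : Fin (n + 1) → ℝ | (∀ i, x i ∈ Icc 0 R) ∧ |∏ i, x i - μ⁻¹| ≤ δ' * g t} := by
    refine MeasurableSet.inter ?_ ?_
    swap
    · change MeasurableSet {x : Fin (n + 1) → ℝ | |∏ i, x i - μ⁻¹| ≤ δ' * g t}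
      exact measurableSet_le (by fun_prop) measurable_const
    have : {x : Fin (n + 1) → ℝ | ∀ i, x i ∈ Icc 0 R} = ⋂ i, {x | x i ∈ Icc 0 R} := by
      ext; simp
    change MeasurableSet {x : Fin (n + 1) → ℝ | ∀ i, x i ∈ Icc 0 R}
    rw [this]
    exact MeasurableSet.iInter fun i => measurable_pi_apply i measurableSet_Icc
  rw [(PiLp.volume_preserving_ofLp (Fin (n + 1))).measure_preimage hclosed.nullMeasurableSet]
  refine (volume_setOf_abs_prod_sub_le hμi hdg0 (by linarith)).trans ?_
  rw [← ENNReal.ofReal_pow hR.le, ← ENNReal.ofReal_mul (by positivity)]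
  refine ENNReal.ofReal_le_ofReal ?_
  calc 4 * R / μ⁻¹ * (δ' * g t) * R ^ n = C * δ' * g t := by rw [hC]; ring
    _ ≤ δ * g t := mul_le_mul_of_nonneg_right hδ1 h0

/-! ### Maximal inequalities -/

/-- Ottaviani's maximal inequality. -/
theorem measure_exists_add_le_norm_le {Ω E : Type*} [MeasurableSpace Ω] {P : Measure Ω}
    [IsProbabilityMeasure P] [NormedAddCommGroup E] [MeasurableSpace E] [BorelSpace E]
    [SecondCountableTopology E] (S : ℕ → Ω → E) (n : ℕ) (hS : ∀ k, Measurable (S k))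
    (hind : ∀ k ≤ n, IndepFun (fun ω (i : Fin (k + 1)) => S i ω) (fun ω => S n ω - S k ω) P)
    (u v : ℝ) (c : ℝ≥0∞) (hc : ∀ k ≤ n, P {ω | v ≤ ‖S n ω - S k ω‖} ≤ c) :
    P {ω | ∃ k ≤ n, u + v ≤ ‖S k ω‖} ≤ P {ω | u ≤ ‖S n ω‖} + c := by
  -- `A k` is the event that the level `u + v` is first reached at time `k`. It depends on `S 0, …,
  -- S k` only, hence is independent of `S n - S k`; on it, either `‖S n‖ ≥ u` or the remaining
  -- increment has norm at least `v`.
  set A : ℕ → Set Ω := fun k => {ω | u + v ≤ ‖S k ω‖ ∧ ∀ i < k, ‖S i ω‖ < u + v} with hA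
  have hAmeas : ∀ k, MeasurableSet (A k) := by
    intro k
    have h1 : MeasurableSet {ω | u + v ≤ ‖S k ω‖} := measurableSet_le measurable_const (hS k).norm
    have h2 : MeasurableSet {ω | ∀ i < k, ‖S i ω‖ < u + v} := by
      have : {ω | ∀ i < k, ‖S i ω‖ < u + v} = ⋂ i, ⋂ (_ : i < k), {ω | ‖S i ω‖ < u + v} := by
        ext ω; simp
      rw [this]
      exact MeasurableSet.iInter fun i => MeasurableSet.iInter fun _ =>
        measurableSet_lt (hS i).norm measurable_const
    exact h1.inter h2
  have hdisj : Pairwise (Function.onFun Disjoint A) := by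
    have key : ∀ i j, i < j → Disjoint (A i) (A j) := by
      intro i j hij
      rw [Set.disjoint_left]
      intro ω h1 h2
      exact absurd h1.1 (not_le.2 (h2.2 i hij))
    intro i j hij
    rcases lt_or_gt_of_ne hij with h | h
    · exact key i j h
    · exact (key j i h).symm
  have hsub : {ω | ∃ k ≤ n, u + v ≤ ‖S k ω‖} ⊆ {ω | u ≤ ‖S n ω‖} ∪
      ⋃ k ∈ Finset.range (n + 1), A k ∩ {ω | v ≤ ‖S n ω - S k ω‖} := by
    intro ω hω
    by_cases hu : u ≤ ‖S n ω‖
    · exact Or.inl hu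
    right
    have hex : ∃ k, k ≤ n ∧ u + v ≤ ‖S k ω‖ := hω
    classical
    obtain ⟨h1, h2⟩ := Nat.find_spec hex
    have hmin : ∀ i < Nat.find hex, ‖S i ω‖ < u + v := by
      intro i hi
      have := Nat.find_min hex hi
      by_contra hcon
      exact this ⟨(hi.le.trans h1), not_lt.1 hcon⟩
    simp only [Set.mem_iUnion, Finset.mem_range]
    refine ⟨Nat.find hex, by omega, ⟨h2, hmin⟩, ?_⟩
    have h3 := norm_sub_norm_le (S (Nat.find hex) ω) (S n ω)
    rw [norm_sub_rev] at h3
    simp only [Set.mem_ofPred_eq]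
    linarith
  have hk : ∀ k ∈ Finset.range (n + 1), P (A k ∩ {ω | v ≤ ‖S n ω - S k ω‖}) ≤ P (A k) * c := by
    intro k hk
    have hkn : k ≤ n := by simpa [Nat.lt_succ_iff] using hk
    set B : Set (Fin (k + 1) → E) :=
      {z | u + v ≤ ‖z (Fin.last k)‖} ∩ ⋂ i : Fin (k + 1), ⋂ (_ : (i : ℕ) < k), {z | ‖z i‖ < u + v}
    have hB : MeasurableSet B :=
      (measurableSet_le measurable_const (measurable_pi_apply _).norm).inter
        (MeasurableSet.iInter fun i => MeasurableSet.iInter fun _ =>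
          measurableSet_lt (measurable_pi_apply i).norm measurable_const)
    have hAB : A k = (fun ω (i : Fin (k + 1)) => S i ω) ⁻¹' B := by
      ext ω
      simp only [hA, B, Set.mem_ofPred_eq, Set.mem_preimage, Set.mem_inter_iff, Set.mem_iInter,
        Fin.val_last]
      refine and_congr_right fun _ => ⟨fun h i hi => h i hi, fun h i hi => h ⟨i, by omega⟩ hi⟩
    have hC : MeasurableSet {z : E | v ≤ ‖z‖} := measurableSet_le measurable_const measurable_norm
    have := (hind k hkn).measure_inter_preimage_eq_mul _ _ hB hC
    rw [← hAB] at this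
    refine this.le.trans ?_
    gcongr
    exact hc k hkn
  calc P {ω | ∃ k ≤ n, u + v ≤ ‖S k ω‖}
      ≤ P {ω | u ≤ ‖S n ω‖} +
        P (⋃ k ∈ Finset.range (n + 1), A k ∩ {ω | v ≤ ‖S n ω - S k ω‖}) :=
        (measure_mono hsub).trans (measure_union_le _ _)
    _ ≤ P {ω | u ≤ ‖S n ω‖} + ∑ k ∈ Finset.range (n + 1), P (A k) * c := by
        gcongr
        exact (measure_biUnion_finset_le _ _).trans (Finset.sum_le_sum hk)
    _ ≤ P {ω | u ≤ ‖S n ω‖} + c := by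
        gcongr
        rw [← Finset.sum_mul, ← measure_biUnion_finset (fun i _ j _ hij => hdisj hij)
          (fun k _ => hAmeas k)]
        exact mul_le_of_le_one_left (by simp) prob_le_one

theorem measure_le_abs_sum_le {Ω ι : Type*} [MeasurableSpace Ω] {P : Measure Ω}
    [IsProbabilityMeasure P] {Z : ι → Ω → ℝ} (hind : iIndepFun Z P)
    (hL : ∀ m, MemLp (Z m) 2 P) (hmean : ∀ m, ∫ ω, Z m ω ∂P = 0) {v : ℝ}
    (hv : ∀ m, variance (Z m) P ≤ v) (B : Finset ι) {x : ℝ} (hx : 0 < x) :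
    P {ω | x ≤ |∑ m ∈ B, Z m ω|} ≤ ENNReal.ofReal (B.card * v / x ^ 2) := by
  have hmem : MemLp (∑ m ∈ B, Z m) 2 P := memLp_finsetSum' B fun m _ => hL m
  have hzero : ∫ ω, (∑ m ∈ B, Z m) ω ∂P = 0 := by
    simp only [Finset.sum_apply]
    rw [integral_finsetSum B fun m _ => (hL m).integrable one_le_two]
    simp [hmean]
  have h := meas_ge_le_variance_div_sq hmem hx
  rw [hzero, IndepFun.variance_sum (fun m _ => hL m) (fun i _ j _ hij => hind.indepFun hij)] at h
  simp only [Finset.sum_apply, sub_zero] at h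
  refine h.trans (ENNReal.ofReal_le_ofReal ?_)
  gcongr
  simpa using Finset.sum_le_card_nsmul B _ v fun m _ => hv m

theorem le_pi_norm_iff_exists {ι : Type*} [Fintype ι] (f : ι → ℝ) {u : ℝ} (hu : 0 < u) :
    u ≤ ‖f‖ ↔ ∃ i, u ≤ |f i| := by
  have := (pi_norm_lt_iff (x := f) hu).not
  push Not at this
  simpa using this

/-- A maximal inequality of Kolmogorov type for sums over boxes, where the maximum is taken over
the upper corners of the boxes in the directions `s`. -/
theorem measure_exists_le_abs_sum_filter_le {Ω : Type*} [MeasurableSpace Ω] {P : Measure Ω}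
    [IsProbabilityMeasure P] {d : ℕ} {Z : (Fin d → ℕ) → Ω → ℝ} (hZ : ∀ m, Measurable (Z m))
    (hind : iIndepFun Z P) (hL : ∀ m, MemLp (Z m) 2 P) (hmean : ∀ m, ∫ ω, Z m ω ∂P = 0) {v : ℝ}
    (hv : ∀ m, variance (Z m) P ≤ v) (N : ℕ) (s : Finset (Fin d)) :
    ∀ (B : Finset (Fin d → ℕ)), (∀ m ∈ B, ∀ i, m i < N) → ∀ {x : ℝ}, 0 < x →
      P {ω | ∃ n : Fin d → Fin (N + 1), 2 ^ s.card * x ≤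
        |∑ m ∈ B with ∀ i ∈ s, m i < (n i : ℕ), Z m ω|} ≤
      2 ^ s.card * ENNReal.ofReal (B.card * v / x ^ 2) := by
  classical
  have hv0 : 0 ≤ v := (variance_nonneg (Z 0) P).trans (hv 0)
  induction s using Finset.induction_on with
  | empty =>
    intro B _ x hx
    simpa using measure_le_abs_sum_le hind hL hmean hv B hx
  | insert i₀ s hi₀ ih =>
    intro B hB x hx
    -- The partial sums in direction `i₀` form a walk in a finite-dimensional space with the sup
    -- norm, which encodes the maximum over the directions in `s`. Ottaviani's inequality with `u =
    -- v` doubles both the threshold and the constant.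
    set S : ℕ → Ω → ((Fin d → Fin (N + 1)) → ℝ) := fun k ω n =>
      ∑ m ∈ B with m i₀ < k ∧ ∀ i ∈ s, m i < (n i : ℕ), Z m ω with hSdef
    have hS : ∀ k, Measurable (S k) := fun k =>
      measurable_pi_lambda _ fun n => by
        simp only [hSdef]
        exact Finset.measurable_sum _ fun m _ => hZ m
    have hSN : ∀ ω n, S N ω n = ∑ m ∈ B with ∀ i ∈ s, m i < (n i : ℕ), Z m ω := by
      intro ω n
      refine Finset.sum_congr (Finset.filter_congr fun m hm => ?_) fun _ _ => rfl
      simp [hB m hm i₀]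
    have hdiff : ∀ k ω n, S N ω n - S k ω n =
        ∑ m ∈ B.filter (fun m => k ≤ m i₀) with ∀ i ∈ s, m i < (n i : ℕ), Z m ω := by
      intro k ω n
      rw [hSN, sub_eq_iff_eq_add', Finset.filter_filter,
        ← Finset.sum_filter_add_sum_filter_not (B.filter fun m => ∀ i ∈ s, m i < (n i : ℕ))
          (fun m => m i₀ < k)]
      congr 1
      · simp only [hSdef, Finset.filter_filter]
        exact Finset.sum_congr (Finset.filter_congr fun m _ => and_comm) fun _ _ => rfl
      · rw [Finset.filter_filter]
        exact Finset.sum_congr (Finset.filter_congr fun m _ => by rw [not_lt, and_comm])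
          fun _ _ => rfl
    have hindS : ∀ k ≤ N,
        IndepFun (fun ω (i : Fin (k + 1)) => S i ω) (fun ω => S N ω - S k ω) P := by
      intro k _
      set T₁ := B.filter (fun m => m i₀ < k)
      set T₂ := B.filter (fun m => k ≤ m i₀)
      have hdis : Disjoint T₁ T₂ := by
        rw [Finset.disjoint_left]
        intro m h1 h2
        exact absurd (Finset.mem_filter.1 h1).2 (not_lt.2 (Finset.mem_filter.1 h2).2)
      have h := hind.indepFun_finset T₁ T₂ hdis hZ
      let φ : (T₁ → ℝ) → (Fin (k + 1) → (Fin d → Fin (N + 1)) → ℝ) := fun z j n =>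
        ∑ m : T₁, if m.1 i₀ < (j : ℕ) ∧ ∀ i ∈ s, m.1 i < (n i : ℕ) then z m else 0
      let ψ : (T₂ → ℝ) → ((Fin d → Fin (N + 1)) → ℝ) := fun z n =>
        ∑ m : T₂, if ∀ i ∈ s, m.1 i < (n i : ℕ) then z m else 0
      have hφ : Measurable φ := measurable_pi_lambda _ fun j => measurable_pi_lambda _ fun n =>
        Finset.measurable_sum _ fun m _ => by
          split_ifs
          · exact measurable_pi_apply m
          · exact measurable_const
      have hψ : Measurable ψ := measurable_pi_lambda _ fun n =>
        Finset.measurable_sum _ fun m _ => by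
          split_ifs
          · exact measurable_pi_apply m
          · exact measurable_const
      have h' := h.comp hφ hψ
      convert! h' using 1
      · ext ω j n
        simp only [hSdef, φ, Function.comp]
        rw [Finset.sum_coe_sort T₁
          (fun m => if m i₀ < (j : ℕ) ∧ ∀ i ∈ s, m i < (n i : ℕ) then Z m ω else 0),
          ← Finset.sum_filter, Finset.filter_filter]
        refine Finset.sum_congr (Finset.filter_congr fun m _ => ?_) fun _ _ => rfl
        refine ⟨fun h => ⟨by have := j.2; omega, h⟩, fun h => h.2⟩
      · ext ω n
        simp only [Pi.sub_apply, hdiff, ψ, Function.comp]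
        rw [Finset.sum_coe_sort T₂
          (fun m => if ∀ i ∈ s, m i < (n i : ℕ) then Z m ω else 0), ← Finset.sum_filter]
    have hy : 0 < 2 ^ s.card * x := by positivity
    -- The increment is a sum over the slab `k ≤ m i₀` of `B`. The induction hypothesis applies to
    -- it because `B` is arbitrary there.
    have hc : ∀ k ≤ N, P {ω | 2 ^ s.card * x ≤ ‖S N ω - S k ω‖} ≤
        2 ^ s.card * ENNReal.ofReal (B.card * v / x ^ 2) := by
      intro k _
      have h1 : {ω | 2 ^ s.card * x ≤ ‖S N ω - S k ω‖} =
          {ω | ∃ n : Fin d → Fin (N + 1), 2 ^ s.card * x ≤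
            |∑ m ∈ B.filter (fun m => k ≤ m i₀) with ∀ i ∈ s, m i < (n i : ℕ), Z m ω|} := by
        ext ω
        simp only [Set.mem_ofPred_eq]
        rw [le_pi_norm_iff_exists _ hy]
        simp only [Pi.sub_apply, hdiff]
      rw [h1]
      refine (ih (B.filter fun m => k ≤ m i₀) (fun m hm => hB m (Finset.mem_filter.1 hm).1)
        hx).trans ?_
      gcongr
      exact Finset.filter_subset _ _
    have hmain := measure_exists_add_le_norm_le S N hS hindS (2 ^ s.card * x) (2 ^ s.card * x) _ hc
    have hlast : P {ω | 2 ^ s.card * x ≤ ‖S N ω‖} ≤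
        2 ^ s.card * ENNReal.ofReal (B.card * v / x ^ 2) := by
      have h1 : {ω | 2 ^ s.card * x ≤ ‖S N ω‖} =
          {ω | ∃ n : Fin d → Fin (N + 1), 2 ^ s.card * x ≤
            |∑ m ∈ B with ∀ i ∈ s, m i < (n i : ℕ), Z m ω|} := by
        ext ω
        simp only [Set.mem_ofPred_eq]
        rw [le_pi_norm_iff_exists _ hy]
        simp only [hSN]
      rw [h1]
      exact ih B hB hx
    rw [Finset.card_insert_of_notMem hi₀]
    calc _ ≤ P {ω | ∃ k ≤ N, 2 ^ s.card * x + 2 ^ s.card * x ≤ ‖S k ω‖} := by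
          refine measure_mono ?_
          rintro ω ⟨n, hn⟩
          refine ⟨n i₀, Nat.lt_succ_iff.1 (n i₀).2, ?_⟩
          rw [le_pi_norm_iff_exists _ (by positivity)]
          refine ⟨n, ?_⟩
          rw [pow_succ, mul_assoc, mul_comm 2 x, ← mul_assoc, mul_two] at hn
          simpa [hSdef, Finset.forall_mem_insert] using hn
      _ ≤ _ := hmain.trans (add_le_add_left hlast _)
      _ = _ := by rw [pow_succ]; ring

/-! ### Dyadic truncation levels and moment series -/

theorem one_le_extLog (c : ℝ) : 1 ≤ extLog c := by
  unfold extLog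
  split_ifs with h
  · exact le_rfl
  · rw [Real.le_log_iff_exp_le ((Real.exp_pos 1).trans_le (not_lt.1 h))]
    exact not_lt.1 h

theorem log_le_extLog {c : ℝ} (hc : 0 < c) : Real.log c ≤ extLog c := by
  unfold extLog
  split_ifs with h
  · rw [Real.log_le_iff_le_exp hc]
    exact h.le
  · exact le_rfl

/-- The truncation level `2 ^ (m / β)`. -/
noncomputable def truncLevel (β : ℝ) (m : ℕ) : ℝ := (2 : ℝ) ^ ((m : ℝ) / β)

theorem truncLevel_pos (β : ℝ) (m : ℕ) : 0 < truncLevel β m := Real.rpow_pos_of_pos two_pos _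

theorem truncLevel_rpow {β : ℝ} (hβ : 0 < β) (m : ℕ) : truncLevel β m ^ β = 2 ^ m := by
  rw [truncLevel, ← Real.rpow_mul two_pos.le, div_mul_cancel₀ _ hβ.ne', Real.rpow_natCast]

theorem truncLevel_add (β : ℝ) (m n : ℕ) :
    truncLevel β (m + n) = truncLevel β m * truncLevel β n := by
  rw [truncLevel, Nat.cast_add, add_div, Real.rpow_add two_pos]; rfl

theorem truncLevel_mono {β : ℝ} (hβ : 0 < β) : Monotone (truncLevel β) := by
  intro m n h
  unfold truncLevel
  gcongr
  norm_num

theorem truncLevel_zero (β : ℝ) : truncLevel β 0 = 1 := by simp [truncLevel]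

theorem truncLevel_eq_pow (β : ℝ) (m : ℕ) : truncLevel β m = truncLevel β 1 ^ m := by
  induction m with
  | zero => simp [truncLevel_zero]
  | succ k ih => rw [truncLevel_add, ih, pow_succ]

theorem one_lt_truncLevel_one {β : ℝ} (hβ : 0 < β) : 1 < truncLevel β 1 := by
  unfold truncLevel
  exact Real.one_lt_rpow one_lt_two (by positivity)

theorem tendsto_truncLevel {β : ℝ} (hβ : 0 < β) : Tendsto (truncLevel β) atTop atTop := by
  have : truncLevel β = fun m => truncLevel β 1 ^ m := funext (truncLevel_eq_pow β)
  rw [this]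
  exact tendsto_pow_atTop_atTop_of_one_lt (one_lt_truncLevel_one hβ)

/-- The first truncation level that is at least `y`. -/
theorem exists_truncLevel_index {β : ℝ} (hβ₁ : 1 ≤ β) (hβ₂ : β < 2) (y : ℝ) :
    ∃ k : ℕ, (∀ m, y ≤ truncLevel β m ↔ k ≤ m) ∧ (k + 1 : ℝ) ≤ 5 * extLog y ∧
      (k ≠ 0 → (2 : ℝ) ^ k ≤ 2 * y ^ β) := by
  have hβ : 0 < β := by linarith
  have hex : ∃ m, y ≤ truncLevel β m := ((tendsto_truncLevel hβ).eventually_ge_atTop y).exists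
  classical
  have hlt : Nat.find hex ≠ 0 → truncLevel β (Nat.find hex - 1) < y := fun hk =>
    not_le.1 (Nat.find_min hex (Nat.sub_one_lt hk))
  refine ⟨Nat.find hex, fun m => ⟨fun h => Nat.find_min' hex h, fun h =>
    (Nat.find_spec hex).trans (truncLevel_mono hβ h)⟩, ?_, ?_⟩
  · by_cases hk : Nat.find hex = 0
    · rw [hk]
      have := one_le_extLog y
      norm_num
      linarith
    · have h1 := hlt hk
      obtain ⟨k, hk'⟩ := Nat.exists_eq_succ_of_ne_zero hk
      rw [hk'] at h1 ⊢
      simp only [Nat.succ_eq_add_one, Nat.add_sub_cancel] at h1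
      have hypos : 0 < y := (truncLevel_pos β k).trans h1
      have h2 : (k : ℝ) / β * Real.log 2 < Real.log y := by
        rw [← Real.log_rpow two_pos]
        exact Real.log_lt_log (truncLevel_pos β k) h1
      have h3 := log_le_extLog hypos
      have h4 := one_le_extLog y
      have h5 := Real.log_two_gt_d9
      -- With `log 2 > 0.69` this gives `k + 2 ≤ (2 / 0.69 + 2) * extLog y`, and the factor is below
      -- `5`.
      have h6 : (k : ℝ) / 2 ≤ k / β := by gcongr
      have h7 : (k : ℝ) / 2 * 0.69 ≤ k / β * Real.log 2 :=
        mul_le_mul h6 (by linarith) (by norm_num) (by positivity)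
      push_cast
      linarith
  · intro hk
    have h1 := hlt hk
    obtain ⟨k, hk'⟩ := Nat.exists_eq_succ_of_ne_zero hk
    rw [hk'] at h1 ⊢
    simp only [Nat.succ_eq_add_one, Nat.add_sub_cancel] at h1
    have h2 : truncLevel β k ^ β ≤ y ^ β := by
      have := truncLevel_pos β k
      gcongr
    rw [truncLevel_rpow hβ] at h2
    rw [Nat.succ_eq_add_one, pow_succ]
    linarith

/-- Only the levels below `y` contribute. There `m + 1` is at most `5 * extLog y`, and the geometric
sum is dominated by its last power, of order `y ^ β`. -/
theorem tsum_tail_le {β : ℝ} (hβ₁ : 1 ≤ β) (hβ₂ : β < 2) (p : ℕ) {y : ℝ} (hy : 0 ≤ y) :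
    ∑' m : ℕ, ENNReal.ofReal (if truncLevel β m < y then (m + 1) ^ p * 2 ^ m else 0) ≤
      ENNReal.ofReal (2 * 5 ^ p * (y ^ β * extLog y ^ p)) := by
  obtain ⟨k, hk, hk1, hk2⟩ := exists_truncLevel_index hβ₁ hβ₂ y
  rw [tsum_eq_sum (s := Finset.range k)]
  swap
  · intro m hm
    rw [if_neg, ENNReal.ofReal_zero]
    exact not_lt.2 ((hk m).2 (by simpa using hm))
  rw [← ENNReal.ofReal_sum_of_nonneg]
  swap
  · intro m _
    split_ifs <;> positivity
  refine ENNReal.ofReal_le_ofReal ?_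
  have hL := one_le_extLog y
  by_cases hk0 : k = 0
  · subst hk0
    simp only [Finset.range_zero, Finset.sum_empty]
    have : 0 ≤ y ^ β := Real.rpow_nonneg hy _
    positivity
  calc ∑ m ∈ Finset.range k, (if truncLevel β m < y then ((m : ℝ) + 1) ^ p * 2 ^ m else 0)
      ≤ ∑ m ∈ Finset.range k, (5 * extLog y) ^ p * (2 : ℝ) ^ m := by
        refine Finset.sum_le_sum fun m hm => ?_
        have hmk : (m : ℝ) + 1 ≤ 5 * extLog y := by
          have : (m : ℝ) + 1 ≤ k := by exact_mod_cast Finset.mem_range.1 hm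
          linarith
        split_ifs
        · gcongr
        · positivity
    _ = (5 * extLog y) ^ p * (2 ^ k - 1) := by
        rw [← Finset.mul_sum, geom_sum_eq (by norm_num)]
        norm_num
    _ ≤ (5 * extLog y) ^ p * (2 * y ^ β) := by
        gcongr
        linarith [hk2 hk0]
    _ = _ := by rw [mul_pow]; ring

/-- The terms start at the first level `k` with `y ≤ truncLevel β k`, where `2 ^ k (y / truncLevel β
k) ^ 2 ≤ y ^ β`. From there on they decay, up to the polynomial factor, with ratio `r = 2 ^ (1 - 2 /
β)`, which is below `1` because `β < 2`. -/
theorem exists_tsum_truncated_le {β : ℝ} (hβ₁ : 1 ≤ β) (hβ₂ : β < 2) (p : ℕ) :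
    ∃ C : ℝ, 0 ≤ C ∧ ∀ y : ℝ, 0 ≤ y →
      ∑' m : ℕ, ENNReal.ofReal
        (if y ≤ truncLevel β m then (m + 1) ^ p * 2 ^ m * (y / truncLevel β m) ^ 2 else 0) ≤
      ENNReal.ofReal (C * (y ^ β * extLog y ^ p)) := by
  have hβ : 0 < β := by linarith
  set r : ℝ := 2 / truncLevel β 1 ^ 2 with hr
  have hl1 := truncLevel_pos β 1
  have hr0 : 0 < r := by positivity
  have hr1 : r < 1 := by
    rw [hr, div_lt_one (by positivity), truncLevel, ← Real.rpow_natCast, ← Real.rpow_mul two_pos.le]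
    nth_rewrite 1 [← Real.rpow_one 2]
    refine Real.rpow_lt_rpow_of_exponent_lt one_lt_two ?_
    push_cast
    rw [one_div_mul_eq_div, lt_div_iff₀ hβ]
    linarith
  have hsum : Summable fun i : ℕ => ((i : ℝ) + 1) ^ p * r ^ i := by
    have h1 := summable_pow_mul_geometric_of_norm_lt_one (R := ℝ) p
      (r := r) (by rwa [Real.norm_of_nonneg hr0.le])
    have h2 := ((summable_nat_add_iff 1).2 h1).mul_right r⁻¹
    refine h2.congr fun i => ?_
    push_cast
    rw [pow_succ]
    field_simp
  set D := ∑' i : ℕ, ((i : ℝ) + 1) ^ p * r ^ i with hD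
  have hD0 : 0 ≤ D := tsum_nonneg fun i => by positivity
  refine ⟨5 ^ p * D, by positivity, fun y hy => ?_⟩
  obtain ⟨k, hk, hk1, -⟩ := exists_truncLevel_index hβ₁ hβ₂ y
  have hL := one_le_extLog y
  rw [← (ENNReal.summable).sum_add_tsum_nat_add' (k := k), Finset.sum_eq_zero, zero_add]
  swap
  · intro m hm
    rw [if_neg, ENNReal.ofReal_zero]
    rw [hk]
    simpa using hm
  have hyk : y ≤ truncLevel β k := (hk k).2 le_rfl
  have hlk := truncLevel_pos β k
  have hyβ : 0 ≤ y ^ β := Real.rpow_nonneg hy _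
  have hmain : 2 ^ k * (y / truncLevel β k) ^ 2 ≤ y ^ β := by
    have h1 : (y / truncLevel β k) ^ 2 ≤ (y / truncLevel β k) ^ β := by
      rw [← Real.rpow_natCast]
      exact Real.rpow_le_rpow_of_exponent_ge_of_imp (by positivity) (by rwa [div_le_one hlk])
        (by push_cast; exact hβ₂.le) (fun _ h => absurd h (by norm_num))
    rw [Real.div_rpow hy hlk.le, truncLevel_rpow hβ] at h1
    calc _ ≤ 2 ^ k * (y ^ β / 2 ^ k) := by gcongr
      _ = y ^ β := by field_simp
  calc _ ≤ ∑' i : ℕ, ENNReal.ofReal (5 ^ p * (y ^ β * extLog y ^ p) *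
          (((i : ℝ) + 1) ^ p * r ^ i)) := by
        refine ENNReal.tsum_le_tsum fun i => ENNReal.ofReal_le_ofReal ?_
        rw [if_pos ((hk _).2 (by omega))]
        -- Uses `i + k + 1 ≤ (k + 1) (i + 1)` to separate the shift from the starting index.
        have e1 : ((i + k : ℕ) : ℝ) + 1 ≤ 5 * extLog y * (i + 1) := by
          push_cast
          have : (0 : ℝ) ≤ k * i := by positivity
          nlinarith
        have e2 : (2 : ℝ) ^ (i + k) * (y / truncLevel β (i + k)) ^ 2 =
            r ^ i * (2 ^ k * (y / truncLevel β k) ^ 2) := by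
          rw [truncLevel_add, truncLevel_eq_pow β i, hr, pow_add, div_pow, div_pow, div_pow,
            mul_pow, ← pow_mul, ← pow_mul, mul_comm 2 i]
          field_simp
        calc _ = (((i + k : ℕ) : ℝ) + 1) ^ p *
              (2 ^ (i + k) * (y / truncLevel β (i + k)) ^ 2) := by ring
          _ ≤ (5 * extLog y * (i + 1)) ^ p * (r ^ i * y ^ β) := by
              rw [e2]
              gcongr
          _ = _ := by rw [mul_pow, mul_pow]; ring
    _ = ENNReal.ofReal (5 ^ p * (y ^ β * extLog y ^ p) * D) := by
        rw [← ENNReal.ofReal_tsum_of_nonneg (fun i => by positivity) (hsum.mul_left _),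
          tsum_mul_left]
    _ = _ := by congr 1; ring

/-! ### Truncated sums and the truncation bias -/

/-- Truncation of a real number at level `L`. -/
noncomputable def trunc (L x : ℝ) : ℝ := if |x| ≤ L then x else 0

theorem measurable_trunc (L : ℝ) : Measurable (trunc L) :=
  Measurable.ite (measurableSet_le measurable_id.abs measurable_const) measurable_id
    measurable_const

theorem abs_trunc_le {L : ℝ} (hL : 0 ≤ L) (x : ℝ) : |trunc L x| ≤ L := by
  unfold trunc
  split_ifs with h
  · exact h
  · simpa using hL

theorem trunc_eq_self {L x : ℝ} (h : |x| ≤ L) : trunc L x = x := if_pos h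

theorem integrable_abs_rpow_of_mul {Ω : Type*} [MeasurableSpace Ω] {P : Measure Ω} {ξ : Ω → ℝ}
    (hξ : AEMeasurable ξ P) {β : ℝ} {p : ℕ}
    (hint : Integrable (fun ω => |ξ ω| ^ β * extLog |ξ ω| ^ p) P) :
    Integrable (fun ω => |ξ ω| ^ β) P := by
  refine hint.mono (hξ.abs.pow_const β).aestronglyMeasurable (Eventually.of_forall fun ω => ?_)
  have h0 : 0 ≤ |ξ ω| ^ β := Real.rpow_nonneg (abs_nonneg _) _
  have h1 : 1 ≤ extLog |ξ ω| ^ p := one_le_pow₀ (one_le_extLog _)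
  rw [Real.norm_of_nonneg h0, Real.norm_of_nonneg (by positivity)]
  nlinarith

section Probability

variable {Ω : Type*} [MeasurableSpace Ω] {P : Measure Ω} [IsProbabilityMeasure P]

theorem memLp_trunc {ξ : Ω → ℝ} (hξ : AEMeasurable ξ P) {L : ℝ} (hL : 0 ≤ L) (q : ℝ≥0∞) :
    MemLp (fun ω => trunc L (ξ ω)) q P :=
  MemLp.of_bound ((measurable_trunc L).comp_aemeasurable hξ).aestronglyMeasurable L
    (Eventually.of_forall fun ω => abs_trunc_le hL (ξ ω))

/-- The deviation probability of the sums over the sub-boxes of a box, bounded by truncation. -/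
theorem measure_exists_lt_abs_sum_sub_le {d : ℕ} {ξ : Ω → ℝ} (hξ : AEMeasurable ξ P)
    {Z : (Fin d → ℕ) → Ω → ℝ} (hZ : ∀ m, Measurable (Z m)) (hind : iIndepFun Z P)
    (hident : ∀ m, IdentDistrib (Z m) ξ P P) (μ : ℝ) {L ε : ℝ} (hL : 0 < L) (hε : 0 < ε)
    (N : Fin d → ℕ) (hdev : (∏ i, (N i : ℝ)) * |∫ ω, trunc L (ξ ω) ∂P - μ| ≤ ε / 2 * L) :
    P {ω | ∃ n : Fin d → ℕ, (∀ i, n i ≤ N i) ∧ ε * L <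
        |∑ k ∈ Fintype.piFinset (fun i => Finset.range (n i)), Z k ω - μ * ∏ i, (n i : ℝ)|} ≤
      (∏ i, (N i : ℝ≥0∞)) * P {ω | L < |ξ ω|} +
        ENNReal.ofReal (2 ^ d * (4 * 4 ^ d / ε ^ 2)) * ((∏ i, (N i : ℝ≥0∞)) *
          ∫⁻ ω, ENNReal.ofReal ((trunc L (ξ ω) / L) ^ 2) ∂P) := by
  set τ := ∫ ω, trunc L (ξ ω) ∂P with hτ
  set B := Fintype.piFinset fun i => Finset.range (N i) with hB
  set Y : (Fin d → ℕ) → Ω → ℝ := fun k ω => trunc L (Z k ω) - τ with hY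
  have hcard : B.card = ∏ i, N i := by simp [hB]
  have hφ : Measurable fun x => trunc L x - τ := (measurable_trunc L).sub_const τ
  have hYm : ∀ k, Measurable (Y k) := fun k => hφ.comp (hZ k)
  have hYind : iIndepFun Y P := hind.comp (fun _ x => trunc L x - τ) fun _ => hφ
  have hYident : ∀ k, IdentDistrib (Y k) (fun ω => trunc L (ξ ω) - τ) P P := fun k =>
    (hident k).comp hφ
  have hT := memLp_trunc hξ hL.le 2
  have hYL : ∀ k, MemLp (Y k) 2 P := fun k =>
    (hYident k).symm.memLp_snd (hT.sub (memLp_const τ))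
  have hYmean : ∀ k, ∫ ω, Y k ω ∂P = 0 := by
    intro k
    rw [(hYident k).integral_eq, integral_sub (hT.integrable one_le_two) (integrable_const τ)]
    simp [hτ]
  set v := ∫ ω, trunc L (ξ ω) ^ 2 ∂P with hv
  have hYvar : ∀ k, variance (Y k) P ≤ v := by
    intro k
    rw [(hYident k).variance_eq, variance_sub_const hT.1]
    exact variance_le_expectation_sq hT.1
  -- Half of the allowed deviation is reserved for the bias of the truncated mean; `2 ^ d` cancels
  -- the threshold factor of the maximal inequality.
  set x := ε / 2 * L / 2 ^ d with hx
  have hxpos : 0 < x := by positivity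
  have hmax := measure_exists_le_abs_sum_filter_le hYm hYind hYL hYmean hYvar
    (Finset.univ.sup N) Finset.univ B
    (fun m hm i => (Finset.mem_range.1 (Fintype.mem_piFinset.1 hm i)).trans_le
      (Finset.le_sup (Finset.mem_univ i))) hxpos
  have hxd : (2 : ℝ) ^ (Finset.univ : Finset (Fin d)).card * x = ε / 2 * L := by
    rw [hx, Finset.card_univ, Fintype.card_fin]; field_simp
  rw [hxd] at hmax
  -- Unless some variable in the large box exceeds `L`, truncation changes nothing, and the centred
  -- truncated sum must carry the other half of the deviation.
  have hsub : {ω | ∃ n : Fin d → ℕ, (∀ i, n i ≤ N i) ∧ ε * L <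
        |∑ k ∈ Fintype.piFinset (fun i => Finset.range (n i)), Z k ω - μ * ∏ i, (n i : ℝ)|} ⊆
      (⋃ k ∈ B, {ω | L < |Z k ω|}) ∪ {ω | ∃ n : Fin d → Fin (Finset.univ.sup N + 1),
        ε / 2 * L ≤ |∑ m ∈ B with ∀ i ∈ Finset.univ, m i < (n i : ℕ), Y m ω|} := by
    rintro ω ⟨n, hn, hlt⟩
    by_cases hbig : ∃ k ∈ B, L < |Z k ω|
    · obtain ⟨k, hk, hkL⟩ := hbig
      exact Or.inl (Set.mem_biUnion hk hkL)
    push Not at hbig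
    right
    refine ⟨fun i => ⟨n i, Nat.lt_succ_of_le ((hn i).trans
      (Finset.le_sup (f := N) (Finset.mem_univ i)))⟩, ?_⟩
    have hfil : (B.filter fun m => ∀ i ∈ Finset.univ, m i < n i) =
        Fintype.piFinset (fun i => Finset.range (n i)) := by
      ext m
      simp only [hB, Finset.mem_filter, Fintype.mem_piFinset, Finset.mem_range, Finset.mem_univ,
        true_imp_iff]
      exact ⟨fun h => h.2, fun h => ⟨fun i => (h i).trans_le (hn i), h⟩⟩
    simp only [hfil]
    have hsubB : Fintype.piFinset (fun i => Finset.range (n i)) ⊆ B := by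
      rw [← hfil]; exact Finset.filter_subset _ _
    have hsum : ∑ k ∈ Fintype.piFinset (fun i => Finset.range (n i)), Y k ω =
        ∑ k ∈ Fintype.piFinset (fun i => Finset.range (n i)), Z k ω - (∏ i, (n i : ℝ)) * τ := by
      simp only [hY, Finset.sum_sub_distrib, Finset.sum_const, Fintype.card_piFinset,
        Finset.card_range, nsmul_eq_mul, Nat.cast_prod]
      congr 1
      exact Finset.sum_congr rfl fun k hk => trunc_eq_self (hbig k (hsubB hk))
    rw [hsum]
    have hprod : (∏ i, (n i : ℝ)) ≤ ∏ i, (N i : ℝ) :=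
      Finset.prod_le_prod (fun i _ => by positivity) fun i _ => by exact_mod_cast hn i
    have hn0 : 0 ≤ ∏ i, (n i : ℝ) := Finset.prod_nonneg fun i _ => by positivity
    have h1 : |(∏ i, (n i : ℝ)) * (τ - μ)| ≤ ε / 2 * L := by
      rw [abs_mul, abs_of_nonneg hn0]
      exact (mul_le_mul_of_nonneg_right hprod (abs_nonneg _)).trans hdev
    have h2 := abs_add_le (∑ k ∈ Fintype.piFinset (fun i => Finset.range (n i)), Z k ω -
      (∏ i, (n i : ℝ)) * τ) ((∏ i, (n i : ℝ)) * (τ - μ))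
    have h3 : ∑ k ∈ Fintype.piFinset (fun i => Finset.range (n i)), Z k ω -
      (∏ i, (n i : ℝ)) * τ + (∏ i, (n i : ℝ)) * (τ - μ) =
      ∑ k ∈ Fintype.piFinset (fun i => Finset.range (n i)), Z k ω - μ * ∏ i, (n i : ℝ) := by ring
    rw [h3] at h2
    linarith
  refine (measure_mono hsub).trans ((measure_union_le _ _).trans (add_le_add ?_ ?_))
  · refine (measure_biUnion_finset_le _ _).trans ?_
    have : ∀ k ∈ B, P {ω | L < |Z k ω|} = P {ω | L < |ξ ω|} := fun k _ =>
      (hident k).measure_mem_eq (s := {x | L < |x|})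
        (measurableSet_lt measurable_const measurable_id.abs)
    rw [Finset.sum_congr rfl this, Finset.sum_const, hcard, nsmul_eq_mul]
    push_cast
    exact le_rfl
  · refine hmax.trans (le_of_eq ?_)
    have hsq : ∫⁻ ω, ENNReal.ofReal ((trunc L (ξ ω) / L) ^ 2) ∂P = ENNReal.ofReal (v / L ^ 2) := by
      rw [← ofReal_integral_eq_lintegral_ofReal _ (Eventually.of_forall fun ω => by positivity)]
      · congr 1
        simp only [div_pow, hv]
        rw [integral_div]
      · simp only [div_pow]
        exact hT.integrable_sq.div_const _
    have hN : (∏ i, (N i : ℝ≥0∞)) = ENNReal.ofReal (B.card : ℝ) := by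
      rw [ENNReal.ofReal_natCast, hcard]; push_cast; rfl
    have hv0 : 0 ≤ v := integral_nonneg fun ω => sq_nonneg _
    rw [hsq, hN, ← ENNReal.ofReal_mul (by positivity), ← ENNReal.ofReal_mul (by positivity)]
    have h2 : (2 : ℝ≥0∞) ^ (Finset.univ : Finset (Fin d)).card = ENNReal.ofReal (2 ^ d) := by
      rw [ENNReal.ofReal_pow two_pos.le]; simp
    rw [h2, ← ENNReal.ofReal_mul (by positivity)]
    congr 1
    rw [hx]
    have h4 : (4 : ℝ) ^ d = 2 ^ d * 2 ^ d := by rw [← mul_pow]; norm_num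
    rw [h4]
    field_simp
    ring

/-- Where `|ξ| > L`, `|ξ| ≤ L ^ (1 - β) |ξ| ^ β`. The bias is thus at most `L ^ (1 - β)` times a
tail expectation that vanishes by dominated convergence, and `L ^ β = 2 ^ m`. -/
theorem tendsto_truncation_bias {ξ : Ω → ℝ} (hξ : Integrable ξ P) {β : ℝ} (hβ₁ : 1 ≤ β)
    (hint : Integrable (fun ω => |ξ ω| ^ β) P) {ε : ℝ} (hε : 0 < ε) :
    ∀ᶠ m : ℕ in atTop, 2 ^ m * |∫ ω, trunc (truncLevel β m) (ξ ω) ∂P - ∫ ω, ξ ω ∂P| ≤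
      ε * truncLevel β m := by
  have hβ : 0 < β := by linarith
  set F : ℕ → Ω → ℝ := fun m ω =>
    {x : ℝ | truncLevel β m < |x|}.indicator (fun x => |x| ^ β) (ξ ω) with hF
  have hset : ∀ m, MeasurableSet {x : ℝ | truncLevel β m < |x|} := fun m =>
    measurableSet_lt measurable_const measurable_id.abs
  have hFm : ∀ m, AEStronglyMeasurable (F m) P := fun m =>
    ((Measurable.indicator (by fun_prop) (hset m)).comp_aemeasurable
      hξ.aemeasurable).aestronglyMeasurable
  have hFle : ∀ m ω, ‖F m ω‖ ≤ |ξ ω| ^ β := by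
    intro m ω
    have h0 : 0 ≤ |ξ ω| ^ β := Real.rpow_nonneg (abs_nonneg _) _
    simp only [hF, Set.indicator]
    split_ifs
    · rw [Real.norm_of_nonneg h0]
    · simpa using h0
  have hlim : Tendsto (fun m => ∫ ω, F m ω ∂P) atTop (𝓝 (∫ _, (0 : ℝ) ∂P)) := by
    refine tendsto_integral_of_dominated_convergence _ hFm hint
      (fun m => Eventually.of_forall (hFle m)) (Eventually.of_forall fun ω => ?_)
    refine tendsto_const_nhds.congr' ?_
    filter_upwards [(tendsto_truncLevel hβ).eventually_ge_atTop |ξ ω|] with m hm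
    simp only [hF]
    rw [Set.indicator_of_notMem]
    simpa using hm
  rw [integral_zero] at hlim
  filter_upwards [hlim.eventually_le_const hε] with m hm
  set L := truncLevel β m with hL
  have hLpos : 0 < L := truncLevel_pos β m
  have hT := (memLp_trunc hξ.aemeasurable hLpos.le 1).integrable le_rfl
  have hFint : Integrable (F m) P := hint.mono' (hFm m) (Eventually.of_forall (hFle m))
  have hdiff : |∫ ω, trunc L (ξ ω) ∂P - ∫ ω, ξ ω ∂P| ≤ L ^ (1 - β) * ∫ ω, F m ω ∂P := by
    rw [← integral_sub hT hξ, ← integral_const_mul]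
    refine (abs_integral_le_integral_abs).trans (integral_mono (hT.sub hξ).abs
      (hFint.const_mul _) fun ω => ?_)
    simp only [hF, trunc, Set.indicator, Set.mem_ofPred_eq, ← hL]
    by_cases h : |ξ ω| ≤ L
    · simp [h, not_lt.2 h]
    · have h' : L < |ξ ω| := not_le.1 h
      simp only [h, h', if_true, if_false, zero_sub, abs_neg]
      have hpos : 0 < |ξ ω| := hLpos.trans h'
      calc |ξ ω| = |ξ ω| ^ (1 - β) * |ξ ω| ^ β := by
            rw [← Real.rpow_add hpos]; simp
        _ ≤ L ^ (1 - β) * |ξ ω| ^ β := by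
            refine mul_le_mul_of_nonneg_right ?_ (Real.rpow_nonneg hpos.le _)
            exact Real.rpow_le_rpow_of_nonpos hLpos h'.le (by linarith)
  calc 2 ^ m * |∫ ω, trunc L (ξ ω) ∂P - ∫ ω, ξ ω ∂P|
      ≤ 2 ^ m * (L ^ (1 - β) * ∫ ω, F m ω ∂P) := by gcongr
    _ = (L ^ β * L ^ (1 - β)) * ∫ ω, F m ω ∂P := by rw [hL, truncLevel_rpow hβ]; ring
    _ = L * ∫ ω, F m ω ∂P := by rw [← Real.rpow_add hLpos]; simp
    _ ≤ ε * L := by rw [mul_comm]; gcongr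

/-! ### Strong law along dyadic boxes -/

theorem tsum_comp_le_tsum {J : Type*} (w : J → ℕ) (p : ℕ)
    (hcard : ∀ m, {j | w j = m}.encard ≤ ((m + 1) ^ p : ℕ)) (f : ℕ → ℝ≥0∞) :
    ∑' j, f (w j) ≤ ∑' m : ℕ, ENNReal.ofReal ((m + 1) ^ p) * f m := by
  rw [← ENNReal.tsum_fiberwise _ w]
  refine ENNReal.tsum_le_tsum fun m => ?_
  have h1 : ∑' j : w ⁻¹' {m}, f (w j) = ∑' _ : w ⁻¹' {m}, f m :=
    tsum_congr fun j => by rw [j.2]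
  rw [h1, ENNReal.tsum_const]
  gcongr
  have h2 : ENat.card (w ⁻¹' {m}) = {j | w j = m}.encard := rfl
  rw [h2]
  have h3 : ENNReal.ofReal (((m : ℝ) + 1) ^ p) = ((((m + 1) ^ p : ℕ) : ℕ∞) : ℝ≥0∞) := by
    rw [ENat.toENNReal_coe, ← ENNReal.ofReal_natCast]
    push_cast
    rfl
  rw [h3]
  exact ENat.toENNReal_le.2 (hcard m)

/-- A strong law of Marcinkiewicz–Zygmund type along a family of boxes of dyadic volumes. -/
theorem ae_finite_setOf_exists_lt_abs_sum_sub {d : ℕ} {ξ : Ω → ℝ} (hξ : Integrable ξ P)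
    {Z : (Fin d → ℕ) → Ω → ℝ} (hZ : ∀ m, Measurable (Z m)) (hind : iIndepFun Z P)
    (hident : ∀ m, IdentDistrib (Z m) ξ P P) {β : ℝ} (hβ₁ : 1 ≤ β) (hβ₂ : β < 2) (p : ℕ)
    (hint : Integrable (fun ω => |ξ ω| ^ β * extLog |ξ ω| ^ p) P)
    {J : Type*} [Countable J] (w : J → ℕ) (N : J → Fin d → ℕ) (hN : ∀ j, ∏ i, N j i = 2 ^ w j)
    (hcard : ∀ m, {j | w j = m}.encard ≤ ((m + 1) ^ p : ℕ)) {ε : ℝ} (hε : 0 < ε) :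
    ∀ᵐ ω ∂P, {j | ∃ n : Fin d → ℕ, (∀ i, n i ≤ N j i) ∧ ε * truncLevel β (w j) <
        |∑ k ∈ Fintype.piFinset (fun i => Finset.range (n i)), Z k ω -
          (∫ ω, ξ ω ∂P) * ∏ i, (n i : ℝ)|}.Finite := by
  set μ := ∫ ω, ξ ω ∂P with hμ
  set bad : J → Set Ω := fun j => {ω | ∃ n : Fin d → ℕ, (∀ i, n i ≤ N j i) ∧
    ε * truncLevel β (w j) < |∑ k ∈ Fintype.piFinset (fun i => Finset.range (n i)), Z k ω -
          μ * ∏ i, (n i : ℝ)|} with hbad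
  obtain ⟨M, hM⟩ := eventually_atTop.1 (tendsto_truncation_bias hξ hβ₁
    (integrable_abs_rpow_of_mul hξ.aemeasurable hint) (half_pos hε))
  set K := ENNReal.ofReal (2 ^ d * (4 * 4 ^ d / ε ^ 2)) with hK
  set f : ℕ → ℝ≥0∞ := fun m => 2 ^ m * P {ω | truncLevel β m < |ξ ω|} + K * (2 ^ m *
    ∫⁻ ω, ENNReal.ofReal ((trunc (truncLevel β m) (ξ ω) / truncLevel β m) ^ 2) ∂P) with hf
  have hprob : ∀ j, M ≤ w j → P (bad j) ≤ f (w j) := by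
    intro j hj
    have hNr : ∏ i, (N j i : ℝ) = 2 ^ w j := by exact_mod_cast hN j
    have hNe : ∏ i, (N j i : ℝ≥0∞) = 2 ^ w j := by exact_mod_cast hN j
    have h := measure_exists_lt_abs_sum_sub_le hξ.aemeasurable hZ hind hident μ
      (truncLevel_pos β (w j)) hε (N j) (by rw [hNr]; exact hM _ hj)
    rwa [hNe] at h
  obtain ⟨C, hC0, hC⟩ := exists_tsum_truncated_le hβ₁ hβ₂ p
  have hfin : ∫⁻ ω, ENNReal.ofReal (|ξ ω| ^ β * extLog |ξ ω| ^ p) ∂P ≠ ∞ := by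
    have := hint.lintegral_lt_top
    exact this.ne
  have hξm := hξ.aemeasurable
  -- By Tonelli, this series and the next are expectations of the deterministic series bounded
  -- above, evaluated at `|ξ|`.
  have hsum1 : ∑' m : ℕ, ENNReal.ofReal ((m + 1) ^ p) *
      (2 ^ m * P {ω | truncLevel β m < |ξ ω|}) ≠ ∞ := by
    have h1 : ∀ m : ℕ, ENNReal.ofReal ((m + 1) ^ p) * (2 ^ m * P {ω | truncLevel β m < |ξ ω|}) =
        ∫⁻ ω, ENNReal.ofReal (if truncLevel β m < |ξ ω| then (m + 1) ^ p * 2 ^ m else 0) ∂P := by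
      intro m
      have h2 : ∀ ω, ENNReal.ofReal (if truncLevel β m < |ξ ω| then ((m : ℝ) + 1) ^ p * 2 ^ m
          else 0) = {ω | truncLevel β m < |ξ ω|}.indicator
            (fun _ => ENNReal.ofReal (((m : ℝ) + 1) ^ p) * 2 ^ m) ω := by
        intro ω
        simp only [Set.indicator, Set.mem_ofPred_eq]
        split_ifs
        · rw [ENNReal.ofReal_mul (by positivity), ENNReal.ofReal_pow two_pos.le]
          simp
        · simp
      simp_rw [h2]
      rw [lintegral_indicator_const₀ (nullMeasurableSet_lt aemeasurable_const hξm.abs), mul_assoc]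
    simp_rw [h1]
    have hmeas : ∀ m : ℕ, AEMeasurable (fun ω => ENNReal.ofReal
        (if truncLevel β m < |ξ ω| then ((m : ℝ) + 1) ^ p * 2 ^ m else 0)) P := fun m =>
      Measurable.comp_aemeasurable (f := ξ)
        (g := fun x => ENNReal.ofReal
          (if truncLevel β m < |x| then ((m : ℝ) + 1) ^ p * 2 ^ m else 0))
        (Measurable.ennreal_ofReal (Measurable.ite
          (measurableSet_lt measurable_const measurable_id.abs) measurable_const
          measurable_const)) hξm
    rw [← lintegral_tsum hmeas]
    refine ((lintegral_mono fun ω => tsum_tail_le hβ₁ hβ₂ p (abs_nonneg (ξ ω))).trans_lt ?_).ne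
    simp_rw [ENNReal.ofReal_mul (show (0 : ℝ) ≤ 2 * 5 ^ p by positivity)]
    rw [lintegral_const_mul' _ _ ENNReal.ofReal_ne_top]
    exact ENNReal.mul_lt_top ENNReal.ofReal_lt_top hfin.lt_top
  have hsum2 : ∑' m : ℕ, ENNReal.ofReal ((m + 1) ^ p) * (2 ^ m *
      ∫⁻ ω, ENNReal.ofReal ((trunc (truncLevel β m) (ξ ω) / truncLevel β m) ^ 2) ∂P) ≠ ∞ := by
    have h1 : ∀ m : ℕ, ENNReal.ofReal ((m + 1) ^ p) * (2 ^ m *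
        ∫⁻ ω, ENNReal.ofReal ((trunc (truncLevel β m) (ξ ω) / truncLevel β m) ^ 2) ∂P) =
        ∫⁻ ω, ENNReal.ofReal (if |ξ ω| ≤ truncLevel β m then
          (m + 1) ^ p * 2 ^ m * (|ξ ω| / truncLevel β m) ^ 2 else 0) ∂P := by
      intro m
      rw [← lintegral_const_mul' _ _ (by simp), ← lintegral_const_mul' _ _ (by simp)]
      refine lintegral_congr fun ω => ?_
      have h2 : (2 : ℝ≥0∞) ^ m = ENNReal.ofReal (2 ^ m) := by
        rw [ENNReal.ofReal_pow two_pos.le]; simp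
      rw [h2, ← ENNReal.ofReal_mul (by positivity), ← ENNReal.ofReal_mul (by positivity)]
      congr 1
      unfold trunc
      split_ifs
      · rw [div_pow, div_pow, sq_abs]; ring
      · simp
    simp_rw [h1]
    have hmeas : ∀ m : ℕ, AEMeasurable (fun ω => ENNReal.ofReal
        (if |ξ ω| ≤ truncLevel β m then
          ((m : ℝ) + 1) ^ p * 2 ^ m * (|ξ ω| / truncLevel β m) ^ 2 else 0)) P := fun m =>
      Measurable.comp_aemeasurable (f := ξ)
        (g := fun x => ENNReal.ofReal (if |x| ≤ truncLevel β m then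
          ((m : ℝ) + 1) ^ p * 2 ^ m * (|x| / truncLevel β m) ^ 2 else 0))
        (Measurable.ennreal_ofReal (Measurable.ite
          (measurableSet_le measurable_id.abs measurable_const) (by fun_prop)
          measurable_const)) hξm
    rw [← lintegral_tsum hmeas]
    refine ((lintegral_mono fun ω => hC |ξ ω| (abs_nonneg (ξ ω))).trans_lt ?_).ne
    simp_rw [ENNReal.ofReal_mul hC0]
    rw [lintegral_const_mul' _ _ ENNReal.ofReal_ne_top]
    exact ENNReal.mul_lt_top ENNReal.ofReal_lt_top hfin.lt_top
  have hfsum : ∑' j, f (w j) ≠ ∞ := by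
    refine ((tsum_comp_le_tsum w p hcard f).trans_lt ?_).ne
    simp only [hf, mul_add]
    rw [ENNReal.tsum_add]
    refine ENNReal.add_lt_top.2 ⟨hsum1.lt_top, ?_⟩
    simp_rw [mul_left_comm _ K]
    rw [ENNReal.tsum_mul_left]
    exact ENNReal.mul_lt_top ENNReal.ofReal_lt_top hsum2.lt_top
  -- Boxes with `w j < M`, for which the bias bound is not available, are discarded; `hcard` makes
  -- them finite in number.
  set bad' : J → Set Ω := fun j => if M ≤ w j then bad j else ∅ with hbad'
  have hbc : ∑' j, P (bad' j) ≠ ∞ := by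
    refine ((ENNReal.tsum_le_tsum fun j => ?_).trans_lt hfsum.lt_top).ne
    simp only [hbad']
    split_ifs with h
    · exact hprob j h
    · simp
  have hsmall : {j | w j < M}.Finite := by
    have : {j | w j < M} = ⋃ m ∈ Finset.range M, {j | w j = m} := by
      ext j; simp
    rw [this]
    refine Set.Finite.biUnion (Finset.finite_toSet _) fun m _ => ?_
    exact Set.encard_lt_top_iff.1 ((hcard m).trans_lt (ENat.natCast_lt_top _))
  filter_upwards [ae_finite_setOfPred_mem hbc] with ω hω
  refine (hω.union hsmall).subset fun j hj => ?_
  by_cases h : M ≤ w j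
  · left
    simp only [hbad', Set.mem_ofPred_eq, h, if_true]
    exact hj
  · exact Or.inr (not_le.1 h)

end Probability

/-! ### From dyadic boxes to uniform rates -/

/-- If only finitely many boxes carry a large deviation, the deviations on these boxes can be
absorbed into a constant. -/
theorem exists_forall_le_add_of_finite {d : ℕ} {J : Type*} (N : J → Fin d → ℕ)
    (D : (Fin d → ℕ) → ℝ) (b : J → ℝ)
    (h : {j | ∃ n : Fin d → ℕ, (∀ i, n i ≤ N j i) ∧ b j < D n}.Finite) :
    ∃ C : ℝ, 0 ≤ C ∧ ∀ j, 0 ≤ b j → ∀ n : Fin d → ℕ, (∀ i, n i ≤ N j i) → D n ≤ b j + C := by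
  have hfin : (⋃ j ∈ {j | ∃ n : Fin d → ℕ, (∀ i, n i ≤ N j i) ∧ b j < D n},
      Set.Iic (N j)).Finite := h.biUnion fun j _ => Set.finite_Iic _
  obtain ⟨C, hC⟩ := (hfin.image D).bddAbove
  refine ⟨max C 0, le_max_right _ _, fun j hj n hn => ?_⟩
  by_cases hlt : b j < D n
  · have : D n ≤ C := hC (Set.mem_image_of_mem D (Set.mem_biUnion (show j ∈ _ from ⟨n, hn, hlt⟩) hn))
    linarith [le_max_left C 0]
  · linarith [not_lt.1 hlt, le_max_right C 0]

/-- The first exponent is determined by the other `d - 1`, each of which is at most `m`. -/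
theorem encard_setOf_sum_eq_le {d : ℕ} (hd : d ≠ 0) (m : ℕ) :
    {j : Fin d → ℕ | ∑ i, j i = m}.encard ≤ ((m + 1) ^ (d - 1) : ℕ) := by
  obtain ⟨n, rfl⟩ := Nat.exists_eq_succ_of_ne_zero hd
  have hmaps : Set.MapsTo Fin.tail {j : Fin (n + 1) → ℕ | ∑ i, j i = m}
      (Fintype.piFinset fun _ : Fin n => Finset.range (m + 1) : Finset (Fin n → ℕ)) := by
    intro j hj
    simp only [Finset.mem_coe, Fintype.mem_piFinset, Finset.mem_range]
    intro i
    have h1 : j i.succ ≤ ∑ i, j i :=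
      Finset.single_le_sum (fun _ _ => Nat.zero_le _) (Finset.mem_univ i.succ)
    rw [show ∑ i, j i = m from hj] at h1
    exact Nat.lt_succ_of_le h1
  have hinj : Set.InjOn (Fin.tail : (Fin (n + 1) → ℕ) → Fin n → ℕ)
      {j : Fin (n + 1) → ℕ | ∑ i, j i = m} := by
    intro j hj k hk hjk
    have h0 : j 0 = k 0 := by
      have e1 : ∑ i, j i = m := hj
      have e2 : ∑ i, k i = m := hk
      rw [Fin.sum_univ_succ] at e1 e2
      have e3 : ∑ i : Fin n, j i.succ = ∑ i : Fin n, k i.succ :=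
        Finset.sum_congr rfl fun i _ => congrFun hjk i
      omega
    funext i
    refine Fin.cases h0 (fun i => congrFun hjk i) i
  refine (Set.encard_le_encard_of_injOn hmaps hinj).trans ?_
  rw [Set.encard_coe_eq_coe_finsetCard]
  simp

theorem encard_setOf_mul_eq_le {d : ℕ} (hd : d ≠ 0) (m : ℕ) :
    {j : ℕ | d * j = m}.encard ≤ ((m + 1) ^ 0 : ℕ) := by
  rw [pow_zero, Nat.cast_one, Set.encard_le_one_iff]
  intro a b ha hb
  exact Nat.eq_of_mul_eq_mul_left (Nat.pos_of_ne_zero hd) (Eq.trans ha hb.symm)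

/-- Replaces the power `|n| ^ (1 / β)` by an affine function of `|n|`, the form that multilinear
interpolation preserves. -/
theorem rpow_le_rpow_add {s T α : ℝ} (hs : 0 ≤ s) (hT : 0 < T) (hα : 0 ≤ α) (hα1 : α ≤ 1) :
    s ^ α ≤ T ^ (-1 + α) * T + T ^ (-1 + α) * s := by
  have hT' : 0 < T ^ (-1 + α) := Real.rpow_pos_of_pos hT _
  rcases le_total s T with h | h
  · have h1 : T ^ (-1 + α) * T = T ^ α := by
      rw [← Real.rpow_add_one hT.ne']; congr 1; ring
    have h2 : s ^ α ≤ T ^ α := Real.rpow_le_rpow hs h hα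
    have : 0 ≤ T ^ (-1 + α) * s := by positivity
    linarith
  · have hs' : 0 < s := hT.trans_le h
    have h1 : s ^ α = s ^ (-1 + α) * s := by
      rw [← Real.rpow_add_one hs'.ne']; congr 1; ring
    have h2 : s ^ (-1 + α) * s ≤ T ^ (-1 + α) * s := by
      refine mul_le_mul_of_nonneg_right ?_ hs
      exact Real.rpow_le_rpow_of_nonpos hT h (by linarith)
    have : 0 ≤ T ^ (-1 + α) * T := by positivity
    linarith

theorem truncLevel_le_of_pow_le {β : ℝ} (hβ : 1 ≤ β) {w : ℕ} {c s : ℝ} (hc : 1 ≤ c) (hs : 0 ≤ s)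
    (h : 2 ^ w ≤ c * s) : truncLevel β w ≤ c * s ^ (1 / β) := by
  have hβ0 : 0 < β := by linarith
  have h1 : truncLevel β w = (2 ^ w : ℝ) ^ (1 / β) := by
    rw [truncLevel, ← Real.rpow_natCast, ← Real.rpow_mul two_pos.le]
    congr 1
    ring
  calc truncLevel β w ≤ (c * s) ^ (1 / β) := by
        rw [h1]
        exact Real.rpow_le_rpow (by positivity) h (by positivity)
    _ = c ^ (1 / β) * s ^ (1 / β) := Real.mul_rpow (by linarith) hs
    _ ≤ c * s ^ (1 / β) := by
        refine mul_le_mul_of_nonneg_right ?_ (Real.rpow_nonneg hs _)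
        calc c ^ (1 / β) ≤ c ^ (1 : ℝ) :=
              Real.rpow_le_rpow_of_exponent_le hc ((div_le_one hβ0).2 hβ)
          _ = c := Real.rpow_one c

theorem multiSum_eq_zero {d : ℕ} (a : (Fin d → ℕ+) → ℝ) {n : Fin d → ℕ} {i : Fin d}
    (hi : n i = 0) : multiSum a n = 0 := by
  unfold multiSum
  refine Finset.sum_eq_zero fun k hk => ?_
  have := Fintype.mem_piFinset.1 hk i
  simp [hi] at this

/-- An affine bound with an additive constant gives the uniform rate. -/
theorem uniformRate_of_forall_exists {d : ℕ} (hd : d ≠ 0) {a : (Fin d → ℕ+) → ℝ} {μ α : ℝ}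
    (hα : 0 < α) {U : Set (EuclideanSpace ℝ (Fin d))} {c : ℝ} (hc : 0 < c)
    (h : ∀ ε > 0, ∃ C : ℝ, ∀ T ≥ 1, ∀ u ∈ U, u ∈ closedOrthant d → ∀ A,
      |multiSum a (cubeVertex (T ^ (1 / (d : ℝ)) • u) A) -
        μ * ∏ i, (cubeVertex (T ^ (1 / (d : ℝ)) • u) A i : ℝ)| ≤
      (ε * c * (T ^ (-1 + α) * T) + C) +
        ε * c * T ^ (-1 + α) * ∏ i, (cubeVertex (T ^ (1 / (d : ℝ)) • u) A i : ℝ)) :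
    UniformRate a μ (fun t => t ^ (-1 + α)) U := by
  intro ε hε
  -- The other half of `ε` absorbs the constant `C`, since `T ^ α → ∞`.
  obtain ⟨C, hC⟩ := h (ε / 2 / c) (by positivity)
  filter_upwards [(tendsto_rpow_atTop hα).eventually_ge_atTop (C / (ε / 2)),
    eventually_ge_atTop 1] with T hT hT1 u hu huo
  have hT0 : 0 < T := by linarith
  have hTd : 0 < T ^ (1 / (d : ℝ)) := Real.rpow_pos_of_pos hT0 _
  have hxo : T ^ (1 / (d : ℝ)) • u ∈ closedOrthant d := fun i => by
    simpa using mul_nonneg hTd.le (huo i)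
  have h1 := abs_interpSum_sub_le a μ _ _ hxo (hC T hT1 u hu huo)
  rw [coordProd_smul, rpow_one_div_pow hd hT0.le] at h1
  have h2 : ε / 2 / c * c = ε / 2 := by field_simp
  rw [h2] at h1
  have h3 : T ^ (-1 + α) * T = T ^ α := by
    rw [← Real.rpow_add_one hT0.ne']; congr 1; ring
  have h4 : C ≤ ε / 2 * (T ^ (-1 + α) * T) := by
    rw [h3, ← div_le_iff₀' (by positivity)]; exact hT
  have h5 : 0 ≤ ε / 2 * T ^ (-1 + α) * (T * coordProd u) := by
    have := coordProd_nonneg huo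
    positivity
  refine h1.trans ?_
  nlinarith

section Probability

variable {Ω : Type*} [MeasurableSpace Ω] {P : Measure Ω} [IsProbabilityMeasure P]

/-- The values `ε = 1 / (q + 1)` suffice, so the exceptional null sets form a countable union. -/
theorem ae_exists_forall_abs_multiSum_sub_le {d : ℕ} {ξ : Ω → ℝ} (hξ : Integrable ξ P)
    {X : (Fin d → ℕ+) → Ω → ℝ} (hX : ∀ m, Measurable (X m)) (hind : iIndepFun X P)
    (hident : ∀ m, IdentDistrib (X m) ξ P P) {β : ℝ} (hβ₁ : 1 ≤ β) (hβ₂ : β < 2) (p : ℕ)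
    (hint : Integrable (fun ω => |ξ ω| ^ β * extLog |ξ ω| ^ p) P)
    {J : Type*} [Countable J] (w : J → ℕ) (N : J → Fin d → ℕ) (hN : ∀ j, ∏ i, N j i = 2 ^ w j)
    (hcard : ∀ m, {j | w j = m}.encard ≤ ((m + 1) ^ p : ℕ)) :
    ∀ᵐ ω ∂P, ∀ ε > 0, ∃ C : ℝ, 0 ≤ C ∧ ∀ j, ∀ n : Fin d → ℕ, (∀ i, n i ≤ N j i) →
      |multiSum (fun m => X m ω) n - (∫ ω, ξ ω ∂P) * ∏ i, (n i : ℝ)| ≤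
        ε * truncLevel β (w j) + C := by
  have hinj : Function.Injective fun (k : Fin d → ℕ) (i : Fin d) => (k i).succPNat := by
    intro k l h
    funext i
    exact Nat.succPNat_injective (congrFun h i)
  have hae := fun q : ℕ => ae_finite_setOf_exists_lt_abs_sum_sub hξ
    (Z := fun k => X fun i => (k i).succPNat) (fun k => hX _) (hind.precomp hinj)
    (fun k => hident _) hβ₁ hβ₂ p hint w N hN hcard (ε := 1 / ((q : ℝ) + 1)) (by positivity)
  filter_upwards [ae_all_iff.2 hae] with ω hω ε hε
  obtain ⟨q, hq⟩ := exists_nat_one_div_lt hε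
  obtain ⟨C, hC0, hC⟩ := exists_forall_le_add_of_finite N
    (fun n => |multiSum (fun m => X m ω) n - (∫ ω, ξ ω ∂P) * ∏ i, (n i : ℝ)|)
    (fun j => 1 / ((q : ℝ) + 1) * truncLevel β (w j)) (hω q)
  refine ⟨C, hC0, fun j n hn => ?_⟩
  have hpos := truncLevel_pos β (w j)
  refine (hC j (by positivity) n hn).trans ?_
  gcongr

theorem ae_uniformRate_univ {d : ℕ} (hd : d ≠ 0) {ξ : Ω → ℝ} (hξ : Integrable ξ P)
    {X : (Fin d → ℕ+) → Ω → ℝ} (hX : ∀ m, Measurable (X m)) (hind : iIndepFun X P)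
    (hident : ∀ m, IdentDistrib (X m) ξ P P) {β : ℝ} (hβ₁ : 1 ≤ β) (hβ₂ : β < 2)
    (hint : Integrable (fun ω => |ξ ω| ^ β * extLog |ξ ω| ^ (d - 1)) P) :
    ∀ᵐ ω ∂P, UniformRate (fun m => X m ω) (∫ ω, ξ ω ∂P) (fun t => t ^ (-1 + 1 / β)) univ := by
  have hβ : 0 < β := by linarith
  have hα : 0 < 1 / β := by positivity
  filter_upwards [ae_exists_forall_abs_multiSum_sub_le hξ hX hind hident hβ₁ hβ₂ (d - 1) hint
    (J := Fin d → ℕ) (fun j => ∑ i, j i) (fun j i => 2 ^ j i)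
    (fun j => Finset.prod_pow_eq_pow_sum _ _ _) (encard_setOf_sum_eq_le hd)] with ω hω
  refine uniformRate_of_forall_exists hd hα (c := 2 ^ d) (by positivity) fun ε hε => ?_
  obtain ⟨C, hC0, hC⟩ := hω ε hε
  refine ⟨C, fun T hT u _ _ A => ?_⟩
  have hT0 : 0 < T := by linarith
  set n := cubeVertex (T ^ (1 / (d : ℝ)) • u) A with hn
  have hTα : 0 < T ^ (-1 + 1 / β) := Real.rpow_pos_of_pos hT0 _
  -- On the coordinate hyperplanes both the sum and `|n|` vanish. They are treated separately
  -- because `2 ^ Nat.log 2 n ≤ n` fails for `n = 0`.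
  by_cases hzero : ∃ i, n i = 0
  · obtain ⟨i, hi⟩ := hzero
    rw [multiSum_eq_zero _ hi, Finset.prod_eq_zero (Finset.mem_univ i) (by simp [hi])]
    simp only [mul_zero, sub_zero, abs_zero, add_zero]
    positivity
  push Not at hzero
  have h1 := hC (fun i => Nat.log 2 (n i) + 1) n
    (fun i => (Nat.lt_pow_succ_log_self one_lt_two (n i)).le)
  -- Rounding each side up to a power of two costs a factor of at most `2` per direction.
  have h2 : (2 : ℝ) ^ (∑ i, (Nat.log 2 (n i) + 1)) ≤ 2 ^ d * ∏ i, (n i : ℝ) := by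
    have h3 : ∏ i, (2 : ℝ) ^ (Nat.log 2 (n i) + 1) ≤ ∏ i, (2 * (n i : ℝ)) := by
      refine Finset.prod_le_prod (fun i _ => by positivity) fun i _ => ?_
      have : (2 : ℝ) ^ Nat.log 2 (n i) ≤ n i := by
        exact_mod_cast Nat.pow_log_le_self 2 (hzero i)
      rw [pow_succ]
      linarith
    rw [← Finset.prod_pow_eq_pow_sum]
    refine h3.trans (le_of_eq ?_)
    rw [Finset.prod_mul_distrib]
    simp
  have hn0 : 0 ≤ ∏ i, (n i : ℝ) := Finset.prod_nonneg fun i _ => by positivity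
  have h4 := truncLevel_le_of_pow_le hβ₁ (one_le_pow₀ one_le_two) hn0 h2
  have h5 := rpow_le_rpow_add hn0 hT0 hα.le ((div_le_one hβ).2 hβ₁)
  calc _ ≤ _ := h1
    _ ≤ ε * (2 ^ d * (T ^ (-1 + 1 / β) * T + T ^ (-1 + 1 / β) * ∏ i, (n i : ℝ))) + C := by
        gcongr
        exact h4.trans (by gcongr)
    _ = _ := by ring

theorem ae_uniformRate_closedBall {d : ℕ} (hd : d ≠ 0) {ξ : Ω → ℝ} (hξ : Integrable ξ P)
    {X : (Fin d → ℕ+) → Ω → ℝ} (hX : ∀ m, Measurable (X m)) (hind : iIndepFun X P)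
    (hident : ∀ m, IdentDistrib (X m) ξ P P) {β : ℝ} (hβ₁ : 1 ≤ β) (hβ₂ : β < 2)
    (hint : Integrable (fun ω => |ξ ω| ^ β) P) :
    ∀ᵐ ω ∂P, ∀ R ≥ 0, UniformRate (fun m => X m ω) (∫ ω, ξ ω ∂P) (fun t => t ^ (-1 + 1 / β))
      (Metric.closedBall 0 R) := by
  have hβ : 0 < β := by linarith
  have hα : 0 < 1 / β := by positivity
  filter_upwards [ae_exists_forall_abs_multiSum_sub_le hξ hX hind hident hβ₁ hβ₂ 0
    (by simpa using hint) (J := ℕ) (fun j => d * j) (fun j _ => 2 ^ j)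
    (fun j => by simp [← pow_mul, mul_comm]) (encard_setOf_mul_eq_le hd)] with ω hω R hR
  refine uniformRate_of_forall_exists hd hα (c := (2 * (R + 1)) ^ d) (by positivity)
    fun ε hε => ?_
  obtain ⟨C, hC0, hC⟩ := hω ε hε
  refine ⟨C, fun T hT u hu huo A => ?_⟩
  have hT0 : 0 < T := by linarith
  set n := cubeVertex (T ^ (1 / (d : ℝ)) • u) A with hn
  have hTα : 0 < T ^ (-1 + 1 / β) := Real.rpow_pos_of_pos hT0 _
  have hTd : 1 ≤ T ^ (1 / (d : ℝ)) := Real.one_le_rpow hT (by positivity)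
  -- Since `T ≥ 1`, the rounding error `1` is at most `T ^ (1 / d)`. All vertices thus lie in a cube
  -- of volume of order `T`, and one dyadic cube covers it.
  have hnle : ∀ i, (n i : ℝ) ≤ T ^ (1 / (d : ℝ)) * (R + 1) := by
    intro i
    have h1 : u i ≤ R := (le_abs_self _).trans
      ((PiLp.norm_apply_le u i).trans (mem_closedBall_zero_iff.1 hu))
    have h2 : (n i : ℝ) ≤ (⌊T ^ (1 / (d : ℝ)) * u i⌋₊ : ℝ) + 1 := by
      simp only [hn, cubeVertex, PiLp.smul_apply, smul_eq_mul]
      split_ifs <;> push_cast <;> linarith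
    have h3 := Nat.floor_le (mul_nonneg (by linarith : 0 ≤ T ^ (1 / (d : ℝ))) (huo i))
    have h4 : T ^ (1 / (d : ℝ)) * u i ≤ T ^ (1 / (d : ℝ)) * R := by gcongr
    linarith
  obtain ⟨j, hj1, hj2⟩ := exists_nat_pow_near
    (show 1 ≤ T ^ (1 / (d : ℝ)) * (R + 1) by nlinarith) one_lt_two
  have h1 := hC (j + 1) n fun i => by
    have := (hnle i).trans hj2.le
    exact_mod_cast this
  have h2 : (2 : ℝ) ^ (d * (j + 1)) ≤ (2 * (R + 1)) ^ d * T := by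
    have h3 : (2 : ℝ) ^ (j + 1) ≤ 2 * (R + 1) * T ^ (1 / (d : ℝ)) := by
      rw [pow_succ]; linarith
    calc (2 : ℝ) ^ (d * (j + 1)) = (2 ^ (j + 1)) ^ d := by rw [← pow_mul, mul_comm]
      _ ≤ (2 * (R + 1) * T ^ (1 / (d : ℝ))) ^ d := by gcongr
      _ = _ := by rw [mul_pow, rpow_one_div_pow hd hT0.le]
  have h4 := truncLevel_le_of_pow_le hβ₁ (one_le_pow₀ (by linarith)) hT0.le h2
  have h5 : T ^ (1 / β) = T ^ (-1 + 1 / β) * T := by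
    rw [← Real.rpow_add_one hT0.ne']; congr 1; ring
  have hn0 : 0 ≤ ∏ i, (n i : ℝ) := Finset.prod_nonneg fun i _ => by positivity
  have h6 : 0 ≤ ε * (2 * (R + 1)) ^ d * T ^ (-1 + 1 / β) * ∏ i, (n i : ℝ) := by positivity
  calc _ ≤ _ := h1
    _ ≤ ε * ((2 * (R + 1)) ^ d * (T ^ (-1 + 1 / β) * T)) + C := by
        gcongr
        rw [← h5]
        exact h4
    _ ≤ _ := by linarith

end Probability

end RenewalSets

/-! ### Assembly -/

theorem mainTheorem5 {Ω : Type*} [MeasurableSpace Ω] (P : Measure Ω) [IsProbabilityMeasure P]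
    (d : ℕ) (hd : 2 ≤ d)
    (ξ : Ω → ℝ) (hξ : Integrable ξ P) (hμ : 0 < ∫ ω, ξ ω ∂P)
    (X : (Fin d → ℕ+) → Ω → ℝ) (hX : ∀ m, Measurable (X m))
    (hindep : iIndepFun X P) (hident : ∀ m, IdentDistrib (X m) ξ P P)
    (β : ℝ) (hβ₁ : 1 ≤ β) (hβ₂ : β < 2) :
    (Integrable (fun ω => |ξ ω| ^ β * RenewalSets.extLog |ξ ω| ^ (d - 1)) P →
      (∀ᵐ ω ∂P, RenewalSets.IsLittleOAtTop
        (fun t => Metric.hausdorffEDist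
          (RenewalSets.scaledRenewalSet (fun m => X m ω) t)
          (RenewalSets.limitSet d (∫ ω, ξ ω ∂P)))
        (fun t => t ^ (-1 + 1 / β))) ∧
      (∀ K : Set (EuclideanSpace ℝ (Fin d)), IsCompact K →
        ∀ᵐ ω ∂P, RenewalSets.IsLittleOAtTop
          (fun t => RenewalSets.symmDiffDist K
            (RenewalSets.scaledRenewalSet (fun m => X m ω) t)
            (RenewalSets.limitSet d (∫ ω, ξ ω ∂P)))
          (fun t => t ^ (-1 + 1 / β)))) ∧
    (Integrable (fun ω => |ξ ω| ^ β) P →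
      ∀ K : Set (EuclideanSpace ℝ (Fin d)), IsCompact K → K ⊆ RenewalSets.openOrthant d →
        (∀ᵐ ω ∂P, RenewalSets.IsLittleOAtTop
          (fun t => RenewalSets.symmDiffDist K
            (RenewalSets.scaledRenewalSet (fun m => X m ω) t)
            (RenewalSets.limitSet d (∫ ω, ξ ω ∂P)))
          (fun t => t ^ (-1 + 1 / β))) ∧
        (∀ᵐ ω ∂P, RenewalSets.IsLittleOAtTop
          (fun t => RenewalSets.localHausdorffEDist K
            (RenewalSets.scaledRenewalSet (fun m => X m ω) t)
            (RenewalSets.limitSet d (∫ ω, ξ ω ∂P)))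
          (fun t => t ^ (-1 + 1 / β))) ∧
        (RenewalSets.CutsRegularly (∫ ω, ξ ω ∂P) K →
          ∀ᵐ ω ∂P, RenewalSets.IsLittleOAtTop
            (fun t => Metric.hausdorffEDist
              (RenewalSets.scaledRenewalSet (fun m => X m ω) t ∩ K)
              (RenewalSets.limitSet d (∫ ω, ξ ω ∂P) ∩ K))
            (fun t => t ^ (-1 + 1 / β)))) := by
  open RenewalSets in
  have hd0 : d ≠ 0 := by omega
  have hβ : 0 < β := by linarith
  have hg0 : ∀ᶠ t : ℝ in atTop, 0 ≤ t ^ (-1 + 1 / β) :=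
    (eventually_ge_atTop 0).mono fun t ht => Real.rpow_nonneg ht _
  have hg1 : ∀ᶠ t : ℝ in atTop, t ^ (-1 + 1 / β) ≤ 1 :=
    (eventually_ge_atTop 1).mono fun t ht => Real.rpow_le_one_of_one_le_of_nonpos ht (by
      linarith [(div_le_one hβ).2 hβ₁])
  have hsq : Integrable (fun ω => |ξ ω| ^ β) P → ∀ᵐ ω ∂P, ∀ R ≥ 0,
      Squeezed (fun m => X m ω) (∫ ω, ξ ω ∂P) (fun t => t ^ (-1 + 1 / β))
        (Metric.closedBall 0 R) := fun hint => by
    filter_upwards [ae_uniformRate_closedBall hd0 hξ hX hindep hident hβ₁ hβ₂ hint] with ω hω R hR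
    exact (hω R hR).squeezed hμ hg0 hg1
  have hmono : ∀ {a : (Fin d → ℕ+) → ℝ} {U V : Set (EuclideanSpace ℝ (Fin d))}, V ⊆ U →
      Squeezed a (∫ ω, ξ ω ∂P) (fun t => t ^ (-1 + 1 / β)) U →
      Squeezed a (∫ ω, ξ ω ∂P) (fun t => t ^ (-1 + 1 / β)) V := fun hVU h δ hδ =>
    (h δ hδ).mono fun t ht u hu => ht u (hVU hu)
  -- A compact set lies in a ball, so the estimate along cubes serves both parts and the logarithm
  -- is not needed here.
  have hsymm : Integrable (fun ω => |ξ ω| ^ β) P →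
      ∀ K : Set (EuclideanSpace ℝ (Fin d)), IsCompact K → ∀ᵐ ω ∂P, IsLittleOAtTop
        (fun t => symmDiffDist K (scaledRenewalSet (fun m => X m ω) t) (limitSet d (∫ ω, ξ ω ∂P)))
        (fun t => t ^ (-1 + 1 / β)) := fun hint K hK => by
    obtain ⟨R, hR, hKR⟩ := hK.isBounded.exists_pos_norm_le
    filter_upwards [hsq hint] with ω hω
    exact isLittleOAtTop_of_forall_le ((hmono (fun x hx => mem_closedBall_zero_iff.2 (hKR x hx))
      (hω R hR.le)).symmDiffDist hd0 hμ hg0 hg1 hK)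
  refine ⟨fun hint => ⟨?_, hsymm (integrable_abs_rpow_of_mul hξ.aemeasurable hint)⟩,
    fun hint K hK _ => ⟨hsymm hint K hK, ?_, fun hcut => ?_⟩⟩
  · filter_upwards [ae_uniformRate_univ hd0 hξ hX hindep hident hβ₁ hβ₂ hint] with ω hω
    refine isLittleOAtTop_of_forall_le fun δ hδ => ?_
    filter_upwards [(hω.squeezed hμ hg0 hg1).localHausdorff hd0 hμ hg0 hg1 (K := univ)
      (fun _ _ _ _ => mem_univ _) δ hδ] with t ht
    exact Metric.hausdorffEDist_le_of_infEDist (fun x hx => ht.1 x ⟨hx, mem_univ x⟩)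
      fun y hy => ht.2 y ⟨hy, mem_univ y⟩
  · obtain ⟨R, hR, hKR⟩ := hK.isBounded.exists_pos_norm_le
    filter_upwards [hsq hint] with ω hω
    refine isLittleOAtTop_of_forall_le fun δ hδ => ?_
    -- Radius `R + 1` makes the ball contain the unit neighbourhood of `K`.
    filter_upwards [(hω (R + 1) (by linarith)).localHausdorff hd0 hμ hg0 hg1 (K := K)
      (fun x hx y hxy => by
        rw [mem_closedBall_zero_iff]
        have h1 := norm_sub_norm_le y x
        rw [← dist_eq_norm, dist_comm] at h1
        linarith [hKR x hx]) δ hδ] with t ht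
    exact max_le (iSup₂_le ht.1) (iSup₂_le ht.2)
  · obtain ⟨R, hR, hKR⟩ := hK.isBounded.exists_pos_norm_le
    filter_upwards [hsq hint] with ω hω
    exact isLittleOAtTop_of_forall_le ((hmono (fun x hx => mem_closedBall_zero_iff.2 (hKR x hx))
      (hω R hR.le)).cutsRegularly hg0 hg1 hcut)
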